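/- **Setting.** A parity game $G=(V,E,c,V_0,V_1)$ consists of a finite set $V$ with at least two vertices, edges $E\subseteq V\times V$ (loops and vertices without successor are allowed), colours $c\colon V\to\{1,\dots,\mathbf C\}$, and a partition $V=V_0\uplus V_1$ into the vertices of players $P_0$ and $P_1$. For $W\subseteq V$, a *$W$-selector* is a partial map $f$ with $\mathrm{dom}(f)\subseteq W$ and $(s,f(s))\in E$ for $s\in\mathrm{dom}(f)$. The outcome of a $V$-selector $f$ from $s$ follows $f$ and stops when it leaves $\mathrm{dom}(f)$. An outcome of a $V_0$-selector $g$ follows $g$ at vertices of $V_0$ (and stops outside $\mathrm{dom}(g)$), and follows an arbitrary edge at vertices of $V_1$ (and stops there only if there is none). A finite outcome is won by $P_0$ iff its last vertex is in $V_1$; an infinite one iff the largest colour seen infinitely often is even. The selector $g$ *wins for $P_0$ from $s$* if all its outcomes from $s$ are won by $P_0$. A $V$-selector $f$ *extends* $g$ if $g$ is the restriction of $f$ to $V_0$. Let $(\mathcal T,\mathbf T)$ be a nice tree decomposition of $G$ (a tree decomposition in which the bags of adjacent nodes differ by exactly one vertex), rooted at a node with bag $\{\sigma\}$, and let $v_1,\dots,v_\ell$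 be a depth-first traversal of $\mathcal T$, i.e. a closed walk from the root using each edge exactly once in each direction. Let $\Theta_i$ be the set of ancestors of $v_i$ (including $v_i$), $\Theta_{\le i}=\bigcup_{1\le j\le i}\Theta_j$, and $\Psi_{>i}$ the set of vertices in no bag $\mathbf T(v)$ with $v\in\Theta_{\le i}$. For $v\in\Theta_i$ let $\Psi_{>i-1}(v)$ be the set of $s\in\Psi_{>i-1}$ such that $v$ is the lowest ancestor in $\Theta_{\le i}$ of the root of the subtree $\{w\mid s\in\mathbf T(w)\}$. The index $i$ is *critical* if $\Psi_{>i}\subsetneq\Psi_{>i-1}$; then $\Psi_{>i-1}=\Psi_{>i}\uplus\{\theta_i\}$ for a unique $\theta_i$. **Views.** Let $\Lambda(v)$ be the set of functions $\mathbf T(v)\to\{?,\top,\bot\}\cup(\mathbf T(v)\times\{1,\dots,\mathbf C\})$ and $\Lambda_i=\prod_{v\in\Theta_i}2^{\Lambda(v)}$. For a $V$-selector $f$ with outcome $s\cdot s_1\cdot s_2\cdots$ from $s\in\mathbf T(v)$, and $P=\Psi_{>i-1}(v)$, let $f_i(v)(s)$ be: $?$ if the first step does not enter $P$ (or if there is no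 step and $s\notin P$); $(s_j,m)$ if $s_1,\dots,s_{j-1}\in P$ and $s_j\notin P$ for some $j\ge2$, with $m$ the largest colour of $s,s_1,\dots,s_{j-1}$; otherwise $\top$ or $\bot$ according to whether $P_0$ wins or loses the outcome. The *selector view* of a $V_0$-selector $g$ is $\omega_i^g\colon v\mapsto\{f_i(v)\mid f\text{ extends }g\}$, $v\in\Theta_i$. **The functions $\Omega_i$.** $\Omega_\ell$ is the constant $v\mapsto\{s\mapsto{?}\}$. For $i\le\ell-1$ and $Z\in\Lambda_{i+1}$, define $\Omega^*_i(Z)$ by $\Omega_i^*(Z)(w)=Z(w)$ for $w\in\Theta_i\setminus\{v_i\}$, and: if $v_{i+1}$ is the parent of $v_i$, $\Omega_i^*(Z)(v_i)=\{s\mapsto{?}\}$; if $v_{i+1}$ is a child of $v_i$, $\Omega_i^*(Z)(v_i)$ is the set of functions on $\mathbf T(v_i)$ given by $s\mapsto\varphi_2(s)$ if $s\in\mathbf T(v_{i+1})$ and $\varphi_2(s)\ne{?}$, and $s\mapsto\varphi_1(s)$ otherwise, where $\varphi_1\in Z(v_i)$ and $\varphi_2\in Z(v_{i+1})$ are such that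 $?\in\{\varphi_1(s),\varphi_2(s)\}$ for all $s\in\mathbf T(v_i)\cap\mathbf T(v_{i+1})$, and the vertices occurring in values of $\varphi_2$ are in $\mathbf T(v_i)$. If $i$ is not critical, $\Omega_i=\Omega_i^*$. Let $i\le\ell-1$ be critical, $\theta=\theta_i$. Vectors $\mathbf B=(\mathbf B_{\theta,s})_{s\in\mathbf T(v_i)}$ and $\mathbf B'=(\mathbf B'_{s,\theta})_{s\in\mathbf T(v_i)}$ are *suitable* if their entries are non-empty subsets of $\{\bot,\top\}$. Put $\Omega_i(Z,\mathbf B,\mathbf B')(w)=\Omega_i^*(Z)(w)$ for $w\ne v_i$, and let $\Omega_i(Z,\mathbf B,\mathbf B')(v_i)$ be the set of the functions $\pi^4(\pi^2(\varphi,S,T))$ with $\varphi\in\Omega_i^*(Z)(v_i)$ and $S,T\subseteq\mathbf T(v_i)$ such that: $|S|\le1$, and $S=\emptyset$ if $\varphi(\theta)\neq{?}$; $S=\{\theta\}$ iff $\theta\in T$; $\top\in\mathbf B_{\theta,s}$ for $s\in S$ and $\bot\in\mathbf B_{\theta,s}$ for $s\in\mathbf T(v_i)\setminus S$; $\top\in\mathbf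 B'_{s,\theta}$ and $\varphi(s)={?}$ for $s\in T$, and $\bot\in\mathbf B'_{s,\theta}$ for $s\in\mathbf T(v_i)\setminus T$. Here $\pi^2(\varphi,S,T)$ maps $\theta$ to $(s,c(\theta))$ if $S=\{s\}$, each other $x\in T$ to $(\theta,c(x))$, and equals $\varphi$ elsewhere; $\pi^3(\varphi)$ is $\top$ if $\varphi(\theta)={?}$ and $\theta\in V_1$ or $\varphi(\theta)=(\theta,m)$ with $m$ even, $\bot$ if $\varphi(\theta)={?}$ and $\theta\in V_0$ or $\varphi(\theta)=(\theta,m)$ with $m$ odd, and $\varphi(\theta)$ otherwise; $\pi^4(\varphi)$ maps $x$ to $\pi^3(\varphi)$ if $x=\theta$, or if $\varphi(x)\in\{\theta\}\times\mathbb N$ and $\pi^3(\varphi)\in\{\bot,\top\}$, to $(s,\max\{m,m'\})$ if $x\neq\theta$, $\varphi(x)=(\theta,m)$ and $\pi^3(\varphi)=(s,m')$, and to $\varphi(x)$ otherwise. **The graph $\Gamma_G$.** Let $\mathrm{choice}(x,y)$ be $\{\{\bot\}\}$ if $(x,y)\notin E$, $\{\{\bot\},\{\top\}\}$ if $(x,y)\in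 E$ and $x\in V_0$, and $\{\{\bot,\top\}\}$ if $(x,y)\in E$ and $x\in V_1$. The labelled edges of $\Gamma_G$ are, for $1\le i\le\ell-1$ and $Z\in\Lambda_{i+1}$: if $i$ is not critical, the neutral edge $(i+1,Z)\xrightarrow{\bullet}(i,\Omega_i(Z))$; if $i$ is critical, for all suitable $\mathbf B,\mathbf B'$, the edges $(i+1,Z)\xrightarrow{i,Z}(i,0)$; $(i,0)\xrightarrow{i,\mathbf B,\mathbf B'}(i,1)$, provided that $\mathbf B_{\theta_i,s}\in\mathrm{choice}(\theta_i,s)$ and $\mathbf B'_{s,\theta_i}\in\mathrm{choice}(s,\theta_i)$ for all $s\in\mathbf T(v_i)$; $(i,1)\xrightarrow{\overline{i,\mathbf B,\mathbf B'}}(i,\mathbf B,\mathbf B')$; $(i,\mathbf B,\mathbf B')\xrightarrow{\overline{i,Z}}(i,\Omega_i(Z,\mathbf B,\mathbf B'))$. A path (a sequence of consecutive labelled edges) is a *Dyck path* if its label is generated by $S\to\varepsilon\mid l\,S\,\bar l\,S\mid S\bullet S$. *Nominal* Dyck paths are the neutral edges and the Dyck paths $(i+1,Z)\to(i,0)\to(i,1)\to(i,\mathbf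 B,\mathbf B')\to(i,Z')$ with labels $(i,Z)$, $(i,\mathbf B,\mathbf B')$, $\overline{i,\mathbf B,\mathbf B'}$, $\overline{i,Z}$; *generic* Dyck paths are the Dyck paths that are concatenations of nominal ones. Let $\mathcal P_\Gamma$ be the set of generic Dyck paths from $(\ell,\Omega_\ell)$ to a vertex $(1,Z)$ with $\emptyset\ne Z\subseteq\Lambda(v_1)$. For $\pi\in\mathcal P_\Gamma$ let $Z(\pi)$ be the set such that $(1,Z(\pi))$ is the sink of $\pi$, and let $E(\pi)$ be the set of the pairs $(\theta_i,s)$ with $\theta_i\in V_0$, $s\in\mathbf T(v_i)$, $\mathbf B_{\theta_i,s}=\{\top\}$, and the pairs $(s,\theta_i)$ with $s\in V_0\cap\mathbf T(v_i)$, $\mathbf B'_{s,\theta_i}=\{\top\}$, for all critical $i$ and all vertices $(i,\mathbf B,\mathbf B')$ that $\pi$ goes through. **Proposition.** For every $V_0$-selector $g$ of $G$ there is a unique $\pi^g\in\mathcal P_\Gamma$ such that $E(\pi^g)=\{(s,g(s))\mid s\in\mathrm{dom}(g)\}$. The function $g\mapsto\pi^g$ is a bijection from the set of $V_0$-selectors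 onto $\mathcal P_\Gamma$. Moreover, $Z(\pi^g)=\omega_1^g(v_1)$, and $g$ wins for $P_0$ from $\sigma$ if and only if $Z(\pi^g)=\{\sigma\mapsto\top\}$. -/

import Mathlib

namespace DyckParity

noncomputable section

open scoped Classical
open Filter

/-! ## Parity games, selectors and outcomes -/

/-- A parity game on the vertex set `V` with colours in `{1, …, C}`. The vertices of `V0` belong to
player `P_0`, all the others to player `P_1`. -/
structure ParityGame (V : Type*) (C : ℕ) where
  E : V → V → Prop
  color : V → ℕ
  one_le_color : ∀ s, 1 ≤ color s
  color_le : ∀ s, color s ≤ C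
  V0 : Set V

variable {V 𝒱 : Type*} {C : ℕ}

/-- A `W`-selector: a partial map with domain included in `W` that follows edges of the game
(`next s = none` means that `s` is outside of the domain). -/
structure Selector (G : ParityGame V C) (W : Set V) where
  next : V → Option V
  next_spec : ∀ s t, next s = some t → s ∈ W ∧ G.E s t

/-- The graph `{(s, f(s)) | s ∈ dom f}` of a selector. -/
def Selector.graph {G : ParityGame V C} {W : Set V} (f : Selector G W) : Set (V × V) :=
  {e | f.next e.1 = some e.2}

/-- A finite or infinite sequence of vertices is a map `p : ℕ → Option V`; a finite one is equal to
`none` after its last vertex. This is the winning condition of `P_0`: a finite sequence must end in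
a vertex of `P_1`, and in an infinite one the largest colour seen infinitely often must be even. -/
def WonByP0 (G : ParityGame V C) (p : ℕ → Option V) : Prop :=
  (∃ n s, p n = some s ∧ p (n + 1) = none ∧ s ∉ G.V0) ∨
  ((∀ n, ∃ s, p n = some s) ∧
    ∃ m, Even m ∧ (∃ᶠ n in atTop, ∃ s, p n = some s ∧ G.color s = m) ∧
      ∀ᶠ n in atTop, ∀ s, p n = some s → G.color s ≤ m)

/-- The unique outcome of a `V`-selector `f` from `s`: it follows `f`, and it stops as soon as it
leaves the domain of `f`. -/
def outcome {G : ParityGame V C} (f : Selector G Set.univ) (s : V) : ℕ → Option V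
  | 0 => some s
  | n + 1 => (outcome f s n).bind f.next

/-- `p` is an outcome from `s` of the `V_0`-selector `g`: at a vertex of `P_0` it follows `g` (and
stops outside of the domain of `g`), at a vertex of `P_1` it follows an arbitrary edge (and stops
only if there is none). -/
def IsOutcome {G : ParityGame V C} (g : Selector G G.V0) (s : V) (p : ℕ → Option V) : Prop :=
  p 0 = some s ∧ ∀ n,
    (p n = none → p (n + 1) = none) ∧
    ∀ x, p n = some x →
      (x ∈ G.V0 → p (n + 1) = g.next x) ∧
      (x ∉ G.V0 → (∃ y, G.E x y ∧ p (n + 1) = some y) ∨ ((∀ y, ¬ G.E x y) ∧ p (n + 1) = none))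

/-- The `V_0`-selector `g` wins for `P_0` from `s`. -/
def WinsFrom {G : ParityGame V C} (g : Selector G G.V0) (s : V) : Prop :=
  ∀ p, IsOutcome g s p → WonByP0 G p

/-- The `V`-selector `f` is an extension of the `V_0`-selector `g`. -/
def Extends {G : ParityGame V C} (f : Selector G Set.univ) (g : Selector G G.V0) : Prop :=
  ∀ s ∈ G.V0, f.next s = g.next s

/-! ## Nice tree decompositions and depth-first traversals -/

/-- A nice tree decomposition of `G`: a tree decomposition such that the bags of two adjacent nodes
differ by exactly one vertex. -/
structure NiceTreeDecomposition (G : ParityGame V C) (𝒱 : Type*) where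
  tree : SimpleGraph 𝒱
  isTree : tree.IsTree
  bag : 𝒱 → Set V
  edge_mem : ∀ s t, G.E s t → ∃ v, s ∈ bag v ∧ t ∈ bag v
  connected : ∀ s, (tree.induce {v | s ∈ bag v}).Connected
  nice : ∀ u v, tree.Adj u v → (symmDiff (bag u) (bag v)).ncard = 1

/-- A nice tree decomposition rooted at the vertex `σ` of `G` (its root has bag `{σ}`), with a
depth-first traversal: a closed walk from the root that uses each edge of the tree exactly once in
each direction. -/
structure Traversal (G : ParityGame V C) (𝒱 : Type*) (σ : V) extends
    NiceTreeDecomposition G 𝒱 where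
  root : 𝒱
  bag_root : bag root = {σ}
  tour : tree.Walk root root
  tour_nodup : tour.darts.Nodup
  tour_covers : ∀ d : tree.Dart, d ∈ tour.darts

namespace Traversal

variable {G : ParityGame V C} {σ : V} (D : Traversal G 𝒱 σ)

/-- The number `ℓ` of nodes `v_1, …, v_ℓ` listed by the traversal. -/
def len : ℕ := D.tour.length + 1

/-- The node `v_i` of the traversal, for `1 ≤ i ≤ ℓ`. -/
def node (i : ℕ) : 𝒱 := D.tour.getVert (i - 1)

/-- The set of ancestors of `v`, including `v` itself. -/
def anc (v : 𝒱) : Set 𝒱 := {u | ∃ p : D.tree.Walk D.root v, p.IsPath ∧ u ∈ p.support}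

/-- `Θ_i` -/
def theta (i : ℕ) : Set 𝒱 := D.anc (D.node i)

/-- `Θ_{≤ i}` -/
def thetaLE (i : ℕ) : Set 𝒱 := {v | ∃ j, 1 ≤ j ∧ j ≤ i ∧ v ∈ D.theta j}

/-- `Ψ_{> i}`: the vertices that belong to no bag of a node of `Θ_{≤ i}`. -/
def psiGT (i : ℕ) : Set V := {s | ∀ v ∈ D.thetaLE i, s ∉ D.bag v}

/-- `v` is the root of the subtree of nodes whose bag contains `s`. -/
def IsTop (s : V) (v : 𝒱) : Prop := s ∈ D.bag v ∧ ∀ w, s ∈ D.bag w → v ∈ D.anc w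

/-- `v` is the lowest ancestor of `w` in `Θ_{≤ i}`, that is, `v = n_i(w)`. -/
def IsLowest (i : ℕ) (w v : 𝒱) : Prop :=
  v ∈ D.anc w ∧ v ∈ D.thetaLE i ∧ ∀ u ∈ D.anc w, u ∈ D.thetaLE i → u ∈ D.anc v

/-- `Ψ_{> i-1}(v)`: the vertices `s ∈ Ψ_{> i-1}` such that `n_i(s) = v`. -/
def region (i : ℕ) (v : 𝒱) : Set V :=
  {s | s ∈ D.psiGT (i - 1) ∧ ∃ r, D.IsTop s r ∧ D.IsLowest i r v}

/-- The index `i` is critical. -/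
def Critical (i : ℕ) : Prop := 1 ≤ i ∧ i ≤ D.len ∧ D.psiGT i ⊂ D.psiGT (i - 1)

/-- For a critical index `i`, the unique vertex `θ_i` of `Ψ_{> i-1} \ Ψ_{> i}`
(and an irrelevant value for other indices). -/
def newVertex (i : ℕ) : V :=
  if h : (D.psiGT (i - 1) \ D.psiGT i).Nonempty then h.some else σ

end Traversal

/-! ## Selector views -/

/-- The set `{?, ⊤, ⊥} ∪ (V × ℕ)` of local views. -/
inductive View (V : Type*) where
  | unknown : View V
  | top : View V
  | bot : View V
  | exit : V → ℕ → View V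

/-- The view of the outcome `s · s_1 · s_2 ⋯` of `f` from `s` relative to a set `P` of vertices:
* `?` if the first step does not enter `P` (or if there is no first step and `s ∉ P`);
* `(s_j, m)` if `s_1, …, s_{j-1} ∈ P` and `s_j ∉ P` for some `j ≥ 2`, where `m` is the largest
  colour among `s, s_1, …, s_{j-1}`;
* `⊤` or `⊥` otherwise, according to whether `P_0` wins or loses the outcome. -/
def viewIn {G : ParityGame V C} (P : Set V) (f : Selector G Set.univ) (s : V) : View V :=
  if (f.next s = none ∧ s ∉ P) ∨ ∃ t, f.next s = some t ∧ t ∉ P then View.unknown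
  else if h : ∃ j, 2 ≤ j ∧ ∃ t, outcome f s j = some t ∧ t ∉ P then
    View.exit (Nat.find_spec h).2.choose
      ((Finset.range (Nat.find h)).sup fun k => (outcome f s k).elim 0 G.color)
  else if WonByP0 G (outcome f s) then View.top
  else View.bot

/-- A function on the bag `T(v)` is represented by the function on `V` that extends it by `?`. -/
abbrev LocalView (V : Type*) := V → View V

/-- The view `? : s ↦ ?`. -/
def allUnknown : LocalView V := fun _ => View.unknown

namespace Traversal

variable {G : ParityGame V C} {σ : V} (D : Traversal G 𝒱 σ)

/-- The set `Λ(v)` of functions `T(v) → {?, ⊤, ⊥} ∪ (T(v) × {1, …, C})`. -/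
def Lam (v : 𝒱) : Set (LocalView V) :=
  {φ | (∀ s, s ∉ D.bag v → φ s = View.unknown) ∧
    ∀ s t m, φ s = View.exit t m → t ∈ D.bag v ∧ 1 ≤ m ∧ m ≤ C}

/-- The selector view `f_i(v)` of a `V`-selector `f`. -/
def selView (f : Selector G Set.univ) (i : ℕ) (v : 𝒱) : LocalView V := fun s =>
  if s ∈ D.bag v then viewIn (D.region i v) f s else View.unknown

/-- The component `ω_i^g(v)` of the selector view `ω_i^g` of a `V_0`-selector `g`. -/
def omegaView (g : Selector G G.V0) (i : ℕ) (v : 𝒱) : Set (LocalView V) :=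
  {φ | ∃ f, Extends f g ∧ φ = D.selView f i v}

/-- The set `Λ_i`, the product of the power sets of the `Λ(v)` with `v ∈ Θ_i`. A family indexed by
`Θ_i` is extended by `∅` to all nodes. -/
def LamIdx (i : ℕ) : Set (𝒱 → Set (LocalView V)) :=
  {Z | (∀ v ∈ D.theta i, Z v ⊆ D.Lam v) ∧ ∀ v, v ∉ D.theta i → Z v = ∅}

/-! ## The functions `Ω_i` -/

/-- The merge `π_i^1` of a view at `v_i` and a view at its child `v_{i+1}`. -/
def merge (i : ℕ) (φ₁ φ₂ : LocalView V) : LocalView V := fun s =>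
  if s ∈ D.bag (D.node i) then (if φ₂ s ≠ View.unknown then φ₂ s else φ₁ s) else View.unknown

/-- The constant `Ω_ℓ`. -/
def omegaLast : 𝒱 → Set (LocalView V) := fun w =>
  if w ∈ D.theta D.len then {allUnknown} else ∅

/-- The function that computes the family of all `ω_i^{* g}(w)`, `w ∈ Θ_i`, from `ω_{i+1}^g`. It is
also `Ω_i` for a non-critical index `i ≤ ℓ - 1`. -/
def omegaStar (i : ℕ) (Z : 𝒱 → Set (LocalView V)) : 𝒱 → Set (LocalView V) := fun w =>
  if w ∉ D.theta i then ∅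
  else if w ≠ D.node i then Z w
  else if D.node (i + 1) ∈ D.anc (D.node i) then {allUnknown}
  else {φ | ∃ φ₁ ∈ Z (D.node i), ∃ φ₂ ∈ Z (D.node (i + 1)),
    (∀ s ∈ D.bag (D.node i) ∩ D.bag (D.node (i + 1)), φ₁ s = View.unknown ∨ φ₂ s = View.unknown) ∧
    (∀ s t m, φ₂ s = View.exit t m → t ∈ D.bag (D.node i)) ∧
    φ = D.merge i φ₁ φ₂}

/-- `π_i^2(φ, S, T)` -/
def setEdges (i : ℕ) (φ : LocalView V) (S T : Set V) : LocalView V := fun x =>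
  if h : x = D.newVertex i ∧ ∃ s, S = {s} then View.exit h.2.choose (G.color (D.newVertex i))
  else if x ∈ T then View.exit (D.newVertex i) (G.color x)
  else φ x

/-- `π_i^3(φ)` -/
def resolveNew (i : ℕ) (φ : LocalView V) : View V :=
  match φ (D.newVertex i) with
  | View.unknown => if D.newVertex i ∈ G.V0 then View.bot else View.top
  | View.top => View.top
  | View.bot => View.bot
  | View.exit t m =>
      if t = D.newVertex i then (if Even m then View.top else View.bot) else View.exit t m

/-- `π_i^4(φ)` -/
def resolve (i : ℕ) (φ : LocalView V) : LocalView V := fun x =>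
  if x = D.newVertex i then D.resolveNew i φ
  else match φ x with
    | View.exit t m =>
        if t = D.newVertex i then
          match D.resolveNew i φ with
          | View.top => View.top
          | View.bot => View.bot
          | View.exit s m' => View.exit s (max m m')
          | View.unknown => View.exit t m
        else View.exit t m
    | y => y

/-- The triple `(φ, S, T)` is adapted at step `i` to the vectors `B = (B_{θ_i,s})` and
`B' = (B'_{s,θ_i})`, with `s ∈ T(v_i)`, where `true` stands for `⊤` and `false` for `⊥`. -/
def Adapted (i : ℕ) (B B' : V → Set Bool) (φ : LocalView V) (S T : Set V) : Prop :=
  S ⊆ D.bag (D.node i) ∧ T ⊆ D.bag (D.node i) ∧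
  S.Subsingleton ∧ (φ (D.newVertex i) ≠ View.unknown → S = ∅) ∧
  (S = {D.newVertex i} ↔ D.newVertex i ∈ T) ∧
  (∀ s ∈ S, true ∈ B s) ∧ (∀ s ∈ D.bag (D.node i) \ S, false ∈ B s) ∧
  (∀ s ∈ T, true ∈ B' s ∧ φ s = View.unknown) ∧ (∀ s ∈ D.bag (D.node i) \ T, false ∈ B' s)

/-- `Ω_i(Z, B, B')` for a critical index `i ≤ ℓ - 1`. -/
def omegaCrit (i : ℕ) (Z : 𝒱 → Set (LocalView V)) (B B' : V → Set Bool) :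
    𝒱 → Set (LocalView V) := fun w =>
  if w = D.node i then
    {ψ | ∃ φ ∈ D.omegaStar i Z (D.node i), ∃ S T, D.Adapted i B B' φ S T ∧
      ψ = D.resolve i (D.setEdges i φ S T)}
  else D.omegaStar i Z w

/-- The pair `B, B'` is suitable at step `i`: the entries are non-empty subsets of `{⊥, ⊤}`. The
vectors are indexed by `T(v_i)` and are extended by `∅` to all vertices. -/
def Suitable (i : ℕ) (B B' : V → Set Bool) : Prop :=
  ∀ s, (s ∈ D.bag (D.node i) → (B s).Nonempty ∧ (B' s).Nonempty) ∧
    (s ∉ D.bag (D.node i) → B s = ∅ ∧ B' s = ∅)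

end Traversal

/-! ## Labelled graphs and Dyck paths -/

/-- Labels: neutral, opening `a` and closing `ā`. -/
inductive Label (A : Type*) where
  | neutral : Label A
  | opening : A → Label A
  | closing : A → Label A

/-- The involution `x ↦ x̄` on labels. -/
def Label.bar {A : Type*} : Label A → Label A
  | .neutral => .neutral
  | .opening a => .closing a
  | .closing a => .opening a

/-- Dyck words, with the grammar `S → ε | l S l̄ S | S • S`, where `l` is not neutral. -/
inductive IsDyck {A : Type*} : List (Label A) → Prop where
  | nil : IsDyck []
  | pair (l : Label A) (u w : List (Label A)) : l ≠ Label.neutral → IsDyck u → IsDyck w →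
      IsDyck (l :: (u ++ l.bar :: w))
  | neutral (u w : List (Label A)) : IsDyck u → IsDyck w → IsDyck (u ++ Label.neutral :: w)

/-- The steps form a walk from `x` to `y`. -/
def IsWalk {X L : Type*} (Edge : X → L → X → Prop) : X → List (X × L × X) → X → Prop
  | x, [], y => x = y
  | x, (a, l, b) :: es, y => a = x ∧ Edge a l b ∧ IsWalk Edge b es y

/-- A path in a labelled graph, given by its labelled edges. -/
structure LabelledPath {X L : Type*} (Edge : X → L → X → Prop) where
  src : X
  steps : List (X × L × X)
  tgt : X
  isWalk : IsWalk Edge src steps tgt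

/-- The path `π` goes through the vertex `x`. -/
def LabelledPath.Visits {X L : Type*} {Edge : X → L → X → Prop} (π : LabelledPath Edge) (x : X) :
    Prop :=
  x = π.src ∨ ∃ e ∈ π.steps, x = e.2.2

/-- The word that labels a path is a Dyck word. -/
def LabelledPath.IsDyckPath {X A : Type*} {Edge : X → Label A → X → Prop}
    (π : LabelledPath Edge) : Prop :=
  IsDyck (π.steps.map fun e => e.2.1)

/-! ## The layered graph `Γ_G` -/

/-- Vertices of the layered graph: `(i, Z)`, `(i, 0)`, `(i, 1)` and `(i, B, B')`. -/
inductive Vertex (V 𝒱 : Type*) where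
  | nominal : ℕ → (𝒱 → Set (LocalView V)) → Vertex V 𝒱
  | zero : ℕ → Vertex V 𝒱
  | one : ℕ → Vertex V 𝒱
  | vectors : ℕ → (V → Set Bool) → (V → Set Bool) → Vertex V 𝒱

/-- Letters of the layered graph: `(i, Z)` and `(i, B, B')`. -/
inductive Letter (V 𝒱 : Type*) where
  | state : ℕ → (𝒱 → Set (LocalView V)) → Letter V 𝒱
  | vectors : ℕ → (V → Set Bool) → (V → Set Bool) → Letter V 𝒱

/-- The set `choice(x, y)` -/
def choice (G : ParityGame V C) (x y : V) : Set (Set Bool) :=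
  if ¬ G.E x y then {{false}}
  else if x ∈ G.V0 then {{false}, {true}}
  else {{false, true}}

namespace Traversal

variable {G : ParityGame V C} {σ : V} (D : Traversal G 𝒱 σ)

/-- The labelled edges of the graph `Γ_G`. -/
inductive Edge : Vertex V 𝒱 → Label (Letter V 𝒱) → Vertex V 𝒱 → Prop where
  | neutral (i : ℕ) (Z : 𝒱 → Set (LocalView V)) :
      1 ≤ i → i + 1 ≤ D.len → ¬ D.Critical i → Z ∈ D.LamIdx (i + 1) →
      Edge (.nominal (i + 1) Z) .neutral (.nominal i (D.omegaStar i Z))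
  | push (i : ℕ) (Z : 𝒱 → Set (LocalView V)) :
      i + 1 ≤ D.len → D.Critical i → Z ∈ D.LamIdx (i + 1) →
      Edge (.nominal (i + 1) Z) (.opening (.state i Z)) (.zero i)
  | choose (i : ℕ) (B B' : V → Set Bool) :
      i + 1 ≤ D.len → D.Critical i → D.Suitable i B B' →
      (∀ s ∈ D.bag (D.node i),
        B s ∈ choice G (D.newVertex i) s ∧ B' s ∈ choice G s (D.newVertex i)) →
      Edge (.zero i) (.opening (.vectors i B B')) (.one i)
  | check (i : ℕ) (B B' : V → Set Bool) :
      i + 1 ≤ D.len → D.Critical i → D.Suitable i B B' →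
      Edge (.one i) (.closing (.vectors i B B')) (.vectors i B B')
  | pop (i : ℕ) (Z : 𝒱 → Set (LocalView V)) (B B' : V → Set Bool) :
      i + 1 ≤ D.len → D.Critical i → Z ∈ D.LamIdx (i + 1) → D.Suitable i B B' →
      Edge (.vectors i B B') (.closing (.state i Z)) (.nominal i (D.omegaCrit i Z B B'))

/-- The sequences of steps of nominal Dyck paths: one neutral step from level `i+1` to level `i`, or
four steps that open and close the letters `(i, Z)` and `(i, B, B')`. -/
def IsNominal (es : List (Vertex V 𝒱 × Label (Letter V 𝒱) × Vertex V 𝒱)) : Prop :=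
  (∃ i Z Z', es = [(.nominal (i + 1) Z, .neutral, .nominal i Z')]) ∨
  (∃ i Z B B' Z', es =
    [(.nominal (i + 1) Z, .opening (.state i Z), .zero i),
     (.zero i, .opening (.vectors i B B'), .one i),
     (.one i, .closing (.vectors i B B'), .vectors i B B'),
     (.vectors i B B', .closing (.state i Z), .nominal i Z')])

/-- Generic Dyck paths: the Dyck paths that are concatenations of nominal Dyck paths. -/
def IsGeneric (π : LabelledPath D.Edge) : Prop :=
  π.IsDyckPath ∧ ∃ bs : List (List (Vertex V 𝒱 × Label (Letter V 𝒱) × Vertex V 𝒱)),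
    (∀ b ∈ bs, IsNominal b) ∧ π.steps = bs.flatten

/-- The class `P_Γ` of generic Dyck paths from `(ℓ, Ω_ℓ)` to a vertex `(1, Z)` such that
`Z = Z(v_1)` is a non-empty subset of `Λ(v_1)`. -/
def DyckClass : Set (LabelledPath D.Edge) :=
  {π | D.IsGeneric π ∧ π.src = .nominal D.len D.omegaLast ∧
    ∃ Z ∈ D.LamIdx 1, π.tgt = .nominal 1 Z ∧ (Z D.root).Nonempty}

/-- The set `Z(π)`, where `(1, Z(π))` is the sink of `π`. -/
def sinkView (π : LabelledPath D.Edge) : Set (LocalView V) :=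
  match π.tgt with
  | .nominal _ Z => Z D.root
  | _ => ∅

/-- The set `E(π)` of edges of `P_0` that are selected along `π`. -/
def chosenEdges (π : LabelledPath D.Edge) : Set (V × V) :=
  {e | ∃ i B B' s, D.Critical i ∧ π.Visits (.vectors i B B') ∧ D.newVertex i ∈ G.V0 ∧
      s ∈ D.bag (D.node i) ∧ B s = {true} ∧ e = (D.newVertex i, s)} ∪
  {e | ∃ i B B' s, D.Critical i ∧ π.Visits (.vectors i B B') ∧ s ∈ G.V0 ∧
      s ∈ D.bag (D.node i) ∧ B' s = {true} ∧ e = (s, D.newVertex i)}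

end Traversal

/-- The function `σ ↦ ⊤` on the bag `{σ}`. -/
def topAt (σ : V) : LocalView V := fun s => if s = σ then View.top else View.unknown

end

end DyckParity

namespace DyckParity

noncomputable section

open scoped Classical
open Filter

namespace Traversal

variable {V 𝒱 : Type*} {C : ℕ} {G : ParityGame V C} {σ : V} (D : Traversal G 𝒱 σ)

/-! ## Ancestors -/

/-! A path of the graph reads the traversal backwards, from level ℓ to level 1, and commits to
vectors (B, B') at each critical index. Every edge of G is examined at the critical index of one of
its ends (`exists_critical_of_edge`), so the vectors restrict the V-selectors that are admissible in
a given set of vertices.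

The invariant is that, after the vectors above level i have been read, the family carried at that
level consists exactly of the local views, at the nodes w of Θ_i, of the selectors admissible in the
region of w (`admissibleViews`). At level ℓ all regions are empty. Ω* either starts an empty region
or merges two regions without edges between them (`omegaStar_admissibleViews`); at a critical index
the new vertex θ is added to the region of v_i (`omegaCrit_admissibleViews`). At level 1 the region
of the root is V.

These computations are local because a bag separates its region from the other vertices
(`region_separated`). A view therefore depends only on the choices made in the region and on the
edges from the bag into it (`regionView_congr`), and partial selectors can be glued (`exists_glue`,
`exists_setEdges`).

So the sink of a path is the set of views at σ of the selectors compatible with all its vectors. If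
the sink is non-empty, one such selector f exists. At an edge from a vertex of P_0, `choice` offers
two singletons and f tells which one was taken, so all vectors are those of the restriction of f to
V_0 (`eq_selectorVectors`). Conversely, the selectors admissible for the vectors of g are the
extensions of g (`admissible_selectorVectors`). This gives the bijection and the value of the sink.

For the winning criterion, g wins iff all its positional extensions do: against a fixed g, P_1 needs
no memory (`winsFrom_iff`). -/

theorem mem_anc_iff {u v : 𝒱} :
    u ∈ D.anc v ↔ ∀ p : D.tree.Walk D.root v, u ∈ p.support := by
  constructor
  · rintro ⟨p, hp, hu⟩ q
    -- The path from the root to `v` is unique, so it is what remains of any walk `q` without its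
    -- detours. Ancestors can then be tested on arbitrary walks, which concatenate freely.
    have h2 : p = q.bypass := congrArg Subtype.val
      ((D.isTree.isAcyclic.subsingleton_path _ _).elim ⟨p, hp⟩ q.toPath)
    rw [h2] at hu
    exact q.support_bypass_subset_support hu
  · intro h
    obtain ⟨p⟩ := D.isTree.connected.preconnected D.root v
    exact ⟨p.bypass, p.bypass_isPath, h _⟩

theorem anc_refl (v : 𝒱) : v ∈ D.anc v :=
  D.mem_anc_iff.2 fun p => p.end_mem_support

theorem anc_trans {u v w : 𝒱} (huv : u ∈ D.anc v) (hvw : v ∈ D.anc w) : u ∈ D.anc w := by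
  rw [mem_anc_iff] at *
  intro p
  exact p.support_takeUntil_subset_support (hvw p) (huv (p.takeUntil v (hvw p)))

theorem root_mem_anc (v : 𝒱) : D.root ∈ D.anc v :=
  D.mem_anc_iff.2 fun p => p.start_mem_support

theorem anc_root : D.anc D.root = {D.root} := by
  ext u
  simp only [Set.mem_singleton_iff]
  constructor
  · intro h
    simpa using D.mem_anc_iff.1 h .nil
  · rintro rfl; exact D.anc_refl _

/-- The distance to the root bounds ancestors strictly. -/
theorem dist_lt_of_anc {u v : 𝒱} (h : u ∈ D.anc v) (hne : u ≠ v) :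
    D.tree.dist D.root u < D.tree.dist D.root v := by
  obtain ⟨p, hp⟩ := D.isTree.connected.exists_walk_length_eq_dist D.root v
  have hu := D.mem_anc_iff.1 h p
  have h1 := SimpleGraph.dist_le (p.takeUntil u hu)
  have h2 := congrArg SimpleGraph.Walk.length (p.take_spec hu)
  rw [SimpleGraph.Walk.length_append] at h2
  have h3 : (p.dropUntil u hu).length ≠ 0 := fun h0 =>
    hne (SimpleGraph.Walk.eq_of_length_eq_zero h0)
  omega

theorem anc_antisymm {u v : 𝒱} (huv : u ∈ D.anc v) (hvu : v ∈ D.anc u) : u = v := by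
  by_contra hne
  have h1 := D.dist_lt_of_anc huv hne
  have h2 := D.dist_lt_of_anc hvu (Ne.symm hne)
  omega

/-- Both nodes lie on the path to `w`: cut it at `v` and see on which part `u` falls. -/
theorem anc_total {u v w : 𝒱} (hu : u ∈ D.anc w) (hv : v ∈ D.anc w) :
    u ∈ D.anc v ∨ v ∈ D.anc u := by
  obtain ⟨p, hp, hup⟩ := hu
  have hvp := D.mem_anc_iff.1 hv p
  rw [← p.take_spec hvp, SimpleGraph.Walk.mem_support_append_iff] at hup
  rcases hup with h | h
  · exact Or.inl ⟨_, hp.takeUntil hvp, h⟩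
  · right
    refine ⟨(p.takeUntil v hvp).append ((p.dropUntil v hvp).takeUntil u h), ?_, ?_⟩
    · have hp2 := hp
      rw [← p.take_spec hvp, ← (p.dropUntil v hvp).take_spec h,
        SimpleGraph.Walk.append_assoc] at hp2
      exact hp2.of_append_left
    · rw [SimpleGraph.Walk.mem_support_append_iff]
      exact Or.inl (SimpleGraph.Walk.end_mem_support _)

theorem anc_of_adj {x y u : 𝒱} (h : D.tree.Adj x y) (hu : u ∈ D.anc y) : u ∈ D.anc x ∨ u = y := by
  by_cases huy : u = y
  · exact Or.inr huy
  left
  rw [mem_anc_iff] at *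
  intro p
  have := hu (p.concat h)
  rw [SimpleGraph.Walk.support_concat] at this
  simpa [huy] using this

theorem parent_of_adj {x y : 𝒱} (h : D.tree.Adj x y) (hy : y ∉ D.anc x) : x ∈ D.anc y := by
  rw [mem_anc_iff] at hy
  push Not at hy
  obtain ⟨p, hp⟩ := hy
  have hp2 : y ∉ p.bypass.support := fun h => hp (p.support_bypass_subset_support h)
  exact ⟨p.bypass.concat h, p.bypass_isPath.concat hp2 h, by
    rw [SimpleGraph.Walk.support_concat]; simp⟩

theorem not_anc_of_adj {x y : 𝒱} (h : D.tree.Adj x y) (hx : x ∈ D.anc y) : y ∉ D.anc x :=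
  fun hy => h.ne (D.anc_antisymm hx hy)

theorem parent_unique {x x' y : 𝒱} (h : D.tree.Adj x y) (h' : D.tree.Adj x' y) (hx : x ∈ D.anc y)
    (hx' : x' ∈ D.anc y) : x = x' := by
  rcases D.anc_of_adj h hx' with h1 | rfl
  · rcases D.anc_of_adj h' hx with h2 | rfl
    · exact D.anc_antisymm h2 h1
    · exact absurd rfl h.ne
  · exact absurd rfl h'.ne

theorem anc_child {x y : 𝒱} (h : D.tree.Adj x y) (hx : x ∈ D.anc y) (u : 𝒱) :
    u ∈ D.anc y ↔ u ∈ D.anc x ∨ u = y := by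
  refine ⟨D.anc_of_adj h, ?_⟩
  rintro (h1 | rfl)
  · exact D.anc_trans h1 hx
  · exact D.anc_refl _

theorem exists_parent {v : 𝒱} (h : v ≠ D.root) : ∃ u, D.tree.Adj u v ∧ u ∈ D.anc v := by
  obtain ⟨p, hp, -⟩ := D.root_mem_anc v
  have hn : ¬ p.Nil := fun hn => h hn.eq.symm
  refine ⟨p.penultimate, p.adj_penultimate hn, p, hp, ?_⟩
  exact p.getVert_mem_support _

/-! ## The traversal -/

theorem node_one : D.node 1 = D.root := by simp [node]

theorem node_len : D.node D.len = D.root := by simp [node, len]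

theorem node_adj {i : ℕ} (h1 : 1 ≤ i) (h : i + 1 ≤ D.len) :
    D.tree.Adj (D.node i) (D.node (i + 1)) := by
  obtain ⟨j, rfl⟩ : ∃ j, i = j + 1 := ⟨i - 1, by omega⟩
  unfold len at h
  exact D.tour.adj_getVert_succ (by omega)

/-- Equal pairs of consecutive nodes are equal darts, and a dart occurs only once in the tour.
Together with `exists_entry`, this yields the order of visits of a depth-first search. -/
theorem step_injective {i j : ℕ} (hi1 : 1 ≤ i) (hi : i + 1 ≤ D.len) (hj1 : 1 ≤ j)
    (hj : j + 1 ≤ D.len) (h0 : D.node i = D.node j) (h1 : D.node (i + 1) = D.node (j + 1)) :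
    i = j := by
  obtain ⟨i, rfl⟩ : ∃ k, i = k + 1 := ⟨i - 1, by omega⟩
  obtain ⟨j, rfl⟩ : ∃ k, j = k + 1 := ⟨j - 1, by omega⟩
  unfold len at hi hj
  have hi' : i < D.tour.darts.length := by rw [SimpleGraph.Walk.length_darts]; omega
  have hj' : j < D.tour.darts.length := by rw [SimpleGraph.Walk.length_darts]; omega
  have := (D.tour_nodup.getElem_inj_iff (hi := hi') (hj := hj')).1 (by
    rw [SimpleGraph.Walk.darts_getElem_eq_getVert, SimpleGraph.Walk.darts_getElem_eq_getVert]
    simp only [node, Nat.add_sub_cancel] at h0 h1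
    simp [h0, h1])
  omega

/-- A stretch of the traversal that enters the subtree below `c` uses the edge to `c`. -/
theorem exists_entry {a b : ℕ} {c : 𝒱} (ha : 1 ≤ a) (hab : a ≤ b) (hb : b ≤ D.len)
    (hca : c ∉ D.anc (D.node a)) (hcb : c ∈ D.anc (D.node b)) :
    ∃ k, a ≤ k ∧ k < b ∧ D.node k ∈ D.anc c ∧ D.tree.Adj (D.node k) c ∧ D.node (k + 1) = c := by
  induction b, hab using Nat.le_induction with
  | base => exact absurd hcb hca
  | succ b hab ih =>
    by_cases h : c ∈ D.anc (D.node b)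
    · obtain ⟨k, h1, h2, h3⟩ := ih (by omega) h
      exact ⟨k, h1, by omega, h3⟩
    · have hadj := D.node_adj (by omega : 1 ≤ b) hb
      have hc := (D.anc_of_adj hadj hcb).resolve_left h
      subst hc
      exact ⟨b, hab, by omega, D.parent_of_adj hadj h, hadj, rfl⟩

theorem exists_node (v : 𝒱) : ∃ j, 1 ≤ j ∧ j ≤ D.len ∧ D.node j = v := by
  by_cases hv : v = D.root
  · exact ⟨1, le_rfl, by simp [len], by rw [hv, node_one]⟩
  · obtain ⟨u, hu, -⟩ := D.exists_parent hv
    have h := D.tour.dart_snd_mem_support_of_mem_darts (D.tour_covers ⟨(u, v), hu⟩)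
    obtain ⟨n, hn, hl⟩ := SimpleGraph.Walk.mem_support_iff_exists_getVert.1 h
    exact ⟨n + 1, by omega, by simp [len]; omega, by simpa [node] using hn⟩

theorem thetaLE_mono {i j : ℕ} (h : i ≤ j) : D.thetaLE i ⊆ D.thetaLE j := by
  rintro v ⟨k, h1, h2, h3⟩
  exact ⟨k, h1, h2.trans h, h3⟩

theorem thetaLE_anc {i : ℕ} {u v : 𝒱} (hv : v ∈ D.thetaLE i) (hu : u ∈ D.anc v) :
    u ∈ D.thetaLE i := by
  obtain ⟨k, h1, h2, h3⟩ := hv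
  exact ⟨k, h1, h2, D.anc_trans hu h3⟩

theorem theta_subset_thetaLE {i : ℕ} (h : 1 ≤ i) : D.theta i ⊆ D.thetaLE i :=
  fun _ hv => ⟨i, h, le_rfl, hv⟩

theorem node_mem_theta (i : ℕ) : D.node i ∈ D.theta i := D.anc_refl _

theorem node_mem_thetaLE {i : ℕ} (h : 1 ≤ i) : D.node i ∈ D.thetaLE i :=
  D.theta_subset_thetaLE h (D.node_mem_theta i)

theorem thetaLE_zero : D.thetaLE 0 = ∅ := by
  ext v; simp only [thetaLE, Set.mem_ofPred_eq, Set.mem_empty_iff_false, iff_false]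
  rintro ⟨j, h1, h2, -⟩; omega

theorem thetaLE_len : D.thetaLE D.len = Set.univ := by
  ext v
  obtain ⟨j, h1, h2, rfl⟩ := D.exists_node v
  simpa using ⟨j, h1, h2, D.anc_refl _⟩

/-- The ancestors of a node are among those of any neighbour, apart from the node itself. So a step
of the tour adds at most its end point to the visited part. -/
theorem thetaLE_succ {i : ℕ} (hi : i + 1 ≤ D.len) {v : 𝒱} (hv : v ∈ D.thetaLE (i + 1)) :
    v ∈ D.thetaLE i ∨ v = D.node (i + 1) := by
  obtain ⟨k, h1, h2, h3⟩ := hv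
  rcases Nat.lt_or_ge k (i + 1) with hk | hk
  · exact Or.inl ⟨k, h1, by omega, h3⟩
  obtain rfl : k = i + 1 := by omega
  rcases Nat.eq_zero_or_pos i with rfl | hi0
  · right
    rw [zero_add] at h3 ⊢
    rw [theta, node_one, anc_root] at h3
    rw [node_one]
    exact h3
  · rcases D.anc_of_adj (D.node_adj hi0 hi) h3 with h | h
    · exact Or.inl ⟨i, hi0, le_rfl, h⟩
    · exact Or.inr h

theorem eq_node_of_new {i : ℕ} (h1 : 1 ≤ i) (hi : i ≤ D.len) {v : 𝒱} (hv : v ∈ D.thetaLE i)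
    (hv' : v ∉ D.thetaLE (i - 1)) : v = D.node i := by
  obtain ⟨i, rfl⟩ : ∃ k, i = k + 1 := ⟨i - 1, by omega⟩
  exact (D.thetaLE_succ hi hv).resolve_left hv'

/-- A child is visited for the first time when the traversal goes down to it. -/
theorem child_not_mem_thetaLE {i : ℕ} (h1 : 1 ≤ i) (hi : i + 1 ≤ D.len)
    (hc : D.node (i + 1) ∉ D.anc (D.node i)) : D.node (i + 1) ∉ D.thetaLE i := by
  rintro ⟨j, hj1, hj2, hj⟩
  have hadj := D.node_adj h1 hi
  have hp := D.parent_of_adj hadj hc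
  have hr : D.node (i + 1) ∉ D.anc (D.node 1) := by
    intro h
    rw [node_one, anc_root, Set.mem_singleton_iff] at h
    exact hc (h ▸ D.root_mem_anc _)
  -- An earlier visit below the child must have entered through its parent, at a step `k < j ≤ i`
  -- along the same dart as step `i`.
  obtain ⟨k, hk1, hk2, hk3, hk4, hk5⟩ := D.exists_entry le_rfl hj1 (by omega) hr hj
  have := D.step_injective hk1 (by omega) h1 hi (D.parent_unique hk4 hadj hk3 hp) hk5
  omega

/-- When the traversal goes up, the whole subtree that it leaves has been visited. -/
theorem mem_thetaLE_of_up {i : ℕ} (h1 : 1 ≤ i) (hi : i + 1 ≤ D.len)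
    (hp : D.node (i + 1) ∈ D.anc (D.node i)) {x : 𝒱} (hx : D.node i ∈ D.anc x) :
    x ∈ D.thetaLE i := by
  by_contra hcon
  obtain ⟨j, hj1, hj2, rfl⟩ := D.exists_node x
  have hij : i < j := by
    by_contra h
    exact hcon ⟨j, hj1, by omega, D.anc_refl _⟩
  have hadj := (D.node_adj h1 hi).symm
  have hnot := D.not_anc_of_adj hadj hp
  have hr : D.node i ∉ D.anc (D.node 1) := by
    intro h
    rw [node_one, anc_root, Set.mem_singleton_iff] at h
    rw [h, anc_root, Set.mem_singleton_iff] at hp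
    rw [h, hp] at hadj
    exact hadj.ne rfl
  -- The tour enters the subtree of `v_i` at a step `k < i`. A later visit would enter it again at a
  -- step `m > i`, along the same dart.
  obtain ⟨k, hk1, hk2, hk3, hk4, hk5⟩ := D.exists_entry le_rfl h1 (by omega) hr (D.anc_refl _)
  obtain ⟨m, hm1, hm2, hm3, hm4, hm5⟩ := D.exists_entry (by omega) hij hj2 hnot hx
  have := D.step_injective hk1 (by omega) (by omega : 1 ≤ m) (by omega)
    (D.parent_unique hk4 hm4 hk3 hm3) (hk5.trans hm5.symm)
  omega

/-- With ℓ = 1 the root would be the only node, and its bag {σ} would contain all vertices. -/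
theorem two_le_len [Nontrivial V] : 2 ≤ D.len := by
  by_contra h
  have hl : D.len = 1 := by unfold len at *; omega
  have hall : ∀ s : V, s = σ := by
    intro s
    obtain ⟨v, hv⟩ := (D.connected s).nonempty
    obtain ⟨j, h1, h2, rfl⟩ := D.exists_node v
    obtain rfl : j = 1 := by omega
    rw [Set.mem_ofPred_eq, node_one, D.bag_root] at hv
    exact hv
  obtain ⟨s, t, hst⟩ := exists_pair_ne V
  exact hst ((hall s).trans (hall t).symm)

/-- The tour ends where it starts, so its last step discovers nothing. Hence ℓ is not critical, and
all regions at level ℓ are empty. -/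
theorem thetaLE_len_pred [Nontrivial V] : D.thetaLE (D.len - 1) = Set.univ := by
  have h2 := D.two_le_len
  ext v
  simp only [Set.mem_univ, iff_true]
  have hv : v ∈ D.thetaLE (D.len - 1 + 1) := by
    rw [Nat.sub_add_cancel (by omega), thetaLE_len]; trivial
  rcases D.thetaLE_succ (by omega) hv with h | h
  · exact h
  · rw [Nat.sub_add_cancel (by omega), node_len] at h
    exact ⟨1, le_rfl, by omega, by rw [h]; exact D.root_mem_anc _⟩

/-! ## Tops of vertices -/

/-- Take the node of the subtree that is closest to the root. A walk inside the connected subtree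
never leaves the descendants of this node, since it would have to step to the parent, which is
closer. -/
theorem exists_isTop (s : V) : ∃ r, D.IsTop s r := by
  have hne : {v | s ∈ D.bag v}.Nonempty := by
    obtain ⟨v, hv⟩ := (D.connected s).nonempty
    exact ⟨v, hv⟩
  obtain ⟨r, hr, hmin⟩ := WellFounded.has_min
    (InvImage.wf (D.tree.dist D.root) Nat.lt_wfRel.wf) _ hne
  refine ⟨r, hr, fun w hw => ?_⟩
  obtain ⟨p⟩ := (D.connected s).preconnected ⟨r, hr⟩ ⟨w, hw⟩
  suffices H : ∀ (a b : {v | s ∈ D.bag v}) (_ : (D.tree.induce {v | s ∈ D.bag v}).Walk a b),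
      r ∈ D.anc a → r ∈ D.anc b from H _ _ p (D.anc_refl r)
  intro a b p
  induction p with
  | nil => exact id
  | @cons a b c hab p ih =>
    intro ha
    refine ih ?_
    have hab' : D.tree.Adj a.1 b.1 := hab
    by_contra hb
    rcases D.anc_of_adj hab'.symm ha with h | h
    · exact hb h
    · have hba : b.1 ∈ D.anc r := by
        have := D.parent_of_adj hab'.symm (h ▸ hb)
        rwa [← h] at this
      exact hmin b.1 b.2 (D.dist_lt_of_anc hba (fun he => hb (by rw [he]; exact D.anc_refl r)))

/-- The root of the subtree of the nodes whose bags contain `s`. -/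
def topNode (s : V) : 𝒱 := (D.exists_isTop s).choose

theorem isTop_topNode (s : V) : D.IsTop s (D.topNode s) := (D.exists_isTop s).choose_spec

theorem mem_bag_topNode (s : V) : s ∈ D.bag (D.topNode s) := (D.isTop_topNode s).1

theorem topNode_anc {s : V} {w : 𝒱} (h : s ∈ D.bag w) : D.topNode s ∈ D.anc w :=
  (D.isTop_topNode s).2 w h

theorem isTop_iff {s : V} {r : 𝒱} : D.IsTop s r ↔ r = D.topNode s := by
  constructor
  · intro h
    exact D.anc_antisymm (h.2 _ (D.mem_bag_topNode s)) (D.topNode_anc h.1)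
  · rintro rfl; exact D.isTop_topNode s

/-- Go from the root to the top node of `s`, then stay in the subtree of `s` up to `w`. As an
ancestor of `w`, `u` lies on this walk; on its first part it can only be the top node. -/
theorem mem_bag_of_between {s : V} {u w : 𝒱} (hw : s ∈ D.bag w) (h1 : D.topNode s ∈ D.anc u)
    (h2 : u ∈ D.anc w) : s ∈ D.bag u := by
  obtain ⟨p⟩ := (D.connected s).preconnected ⟨D.topNode s, D.mem_bag_topNode s⟩ ⟨w, hw⟩
  obtain ⟨q, hq, hqu⟩ := D.anc_refl (D.topNode s)
  have hu := D.mem_anc_iff.1 h2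
    (q.append (p.map (SimpleGraph.Embedding.induce {v | s ∈ D.bag v}).toHom))
  replace hu := (SimpleGraph.Walk.mem_support_append_iff _ _).1 hu
  rcases hu with hu | hu
  · have : u ∈ D.anc (D.topNode s) := ⟨q, hq, hu⟩
    rw [D.anc_antisymm this h1]
    exact D.mem_bag_topNode s
  · have e := SimpleGraph.Walk.support_map
      (SimpleGraph.Embedding.induce (G := D.tree) {v | s ∈ D.bag v}).toHom p
    obtain ⟨x, -, rfl⟩ := List.mem_map.1 ((congrArg (u ∈ ·) e).mp hu)
    exact x.2

/-- The visited part is closed under ancestors, so a bag containing `s` has been visited only if the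
top node of `s` has. From here on, a vertex is located by its top node. -/
theorem mem_psiGT {i : ℕ} {s : V} : s ∈ D.psiGT i ↔ D.topNode s ∉ D.thetaLE i := by
  constructor
  · intro h ht
    exact h _ ht (D.mem_bag_topNode s)
  · intro h v hv hs
    exact h (D.thetaLE_anc hv (D.topNode_anc hs))

theorem mem_region {i : ℕ} {w : 𝒱} {s : V} :
    s ∈ D.region i w ↔ D.topNode s ∉ D.thetaLE (i - 1) ∧ D.IsLowest i (D.topNode s) w := by
  simp only [region, Set.mem_ofPred_eq, mem_psiGT, isTop_iff, exists_eq_left]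

theorem isLowest_unique {i : ℕ} {x w w' : 𝒱} (h : D.IsLowest i x w) (h' : D.IsLowest i x w') :
    w = w' :=
  D.anc_antisymm (h'.2.2 w h.1 h.2.1) (h.2.2 w' h'.1 h'.2.1)

theorem isLowest_self {i : ℕ} {x : 𝒱} (h : x ∈ D.thetaLE i) : D.IsLowest i x x :=
  ⟨D.anc_refl x, h, fun _ hu _ => hu⟩

/-! ## Critical indices -/

theorem psiGT_antitone {i j : ℕ} (h : i ≤ j) : D.psiGT j ⊆ D.psiGT i := fun s hs => by
  rw [mem_psiGT] at *
  exact fun h' => hs (D.thetaLE_mono h h')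

/-- A vertex that leaves Ψ at step `i` has `v_i` as its top node, so it is in the bag of `v_i` but
not in that of `v_{i-1}`. Niceness leaves room for only one such vertex; for `i = 1` the bag is {σ}.
-/
theorem new_unique {i : ℕ} (h1 : 1 ≤ i) (hi : i ≤ D.len) {s t : V}
    (hs : s ∈ D.psiGT (i - 1) \ D.psiGT i) (ht : t ∈ D.psiGT (i - 1) \ D.psiGT i) : s = t := by
  have key : ∀ {s : V}, s ∈ D.psiGT (i - 1) \ D.psiGT i →
      s ∈ D.bag (D.node i) ∧ D.node i ∉ D.thetaLE (i - 1) := by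
    intro s hs
    obtain ⟨h0, h2⟩ := hs
    rw [mem_psiGT] at h0 h2
    push Not at h2
    have := D.eq_node_of_new h1 hi h2 h0
    exact ⟨this ▸ D.mem_bag_topNode s, this ▸ h0⟩
  rcases Nat.lt_or_ge 1 i with hi2 | hi2
  · obtain ⟨k, rfl⟩ : ∃ k, i = k + 1 := ⟨i - 1, by omega⟩
    have hk : 1 ≤ k := by omega
    have hadj := D.node_adj hk hi
    have hcard := D.nice _ _ hadj
    obtain ⟨a, ha⟩ := Set.ncard_eq_one.1 hcard
    have hmem : ∀ {s : V}, s ∈ D.psiGT (k + 1 - 1) \ D.psiGT (k + 1) → s = a := by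
      intro s hs
      have : s ∈ symmDiff (D.bag (D.node k)) (D.bag (D.node (k + 1))) :=
        Or.inr ⟨(key hs).1, fun h => hs.1 _ (D.node_mem_thetaLE hk) h⟩
      rw [ha] at this
      exact this
    rw [hmem hs, hmem ht]
  · obtain rfl : i = 1 := by omega
    have := (key hs).1
    have h2 := (key ht).1
    rw [node_one, D.bag_root] at this h2
    rw [this, h2]

variable {D}

theorem Critical.newVertex_mem {i : ℕ} (h : D.Critical i) :
    D.newVertex i ∈ D.psiGT (i - 1) \ D.psiGT i := by
  obtain ⟨s, hs, hs'⟩ := Set.exists_of_ssubset h.2.2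
  have hne : (D.psiGT (i - 1) \ D.psiGT i).Nonempty := ⟨s, hs, hs'⟩
  rw [newVertex, dif_pos hne]
  exact hne.some_mem

theorem Critical.topNode_eq {i : ℕ} (h : D.Critical i) : D.topNode (D.newVertex i) = D.node i := by
  have := h.newVertex_mem
  rw [Set.mem_sdiff, mem_psiGT, mem_psiGT, not_not] at this
  exact D.eq_node_of_new h.1 h.2.1 this.2 this.1

theorem Critical.newVertex_mem_bag {i : ℕ} (h : D.Critical i) :
    D.newVertex i ∈ D.bag (D.node i) := h.topNode_eq ▸ D.mem_bag_topNode _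

theorem Critical.node_notMem {i : ℕ} (h : D.Critical i) : D.node i ∉ D.thetaLE (i - 1) := by
  have := h.newVertex_mem.1
  rwa [mem_psiGT, h.topNode_eq] at this

theorem Critical.lt_len [Nontrivial V] {i : ℕ} (h : D.Critical i) : i + 1 ≤ D.len := by
  have h2 := h.2.1
  rcases Nat.lt_or_ge i D.len with h3 | h3
  · exact h3
  · obtain rfl : i = D.len := by omega
    have := h.node_notMem
    rw [thetaLE_len_pred] at this
    exact absurd trivial this

variable (D)

theorem exists_critical (s : V) : ∃ i, D.Critical i ∧ D.newVertex i = s := by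
  have hex : ∃ i, s ∉ D.psiGT i := ⟨D.len, by rw [mem_psiGT, thetaLE_len]; simp⟩
  have hspec := Nat.find_spec hex
  have hmin := fun m => @Nat.find_min _ _ hex m
  have hle : Nat.find hex ≤ D.len := Nat.find_min' hex (by rw [mem_psiGT, thetaLE_len]; simp)
  set i := Nat.find hex
  have h1 : 1 ≤ i := by
    by_contra h
    have h0 : i = 0 := by omega
    rw [h0, mem_psiGT, thetaLE_zero] at hspec
    exact hspec id
  have hmem : s ∈ D.psiGT (i - 1) := not_not.1 (hmin (i - 1) (by omega))
  have hc : D.Critical i := ⟨h1, hle, D.psiGT_antitone (by omega), fun h => hspec (h hmem)⟩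
  exact ⟨i, hc, D.new_unique h1 hle hc.newVertex_mem ⟨hmem, hspec⟩⟩

variable {D} in
theorem Critical.eq_of_node_eq {i j : ℕ} (hi : D.Critical i) (hj : D.Critical j)
    (h : D.newVertex i = D.newVertex j) : i = j := by
  by_contra hne
  rcases Nat.lt_or_gt_of_ne hne with hlt | hlt
  · exact hi.newVertex_mem.2 (h ▸ D.psiGT_antitone (by omega) hj.newVertex_mem.1)
  · exact hj.newVertex_mem.2 (h ▸ D.psiGT_antitone (by omega) hi.newVertex_mem.1)

/-- If two vertices share a bag, one of them lies in the bag where the other one is introduced. -/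
theorem mem_bag_topNode_or {s t : V} {x : 𝒱} (hs : s ∈ D.bag x) (ht : t ∈ D.bag x) :
    t ∈ D.bag (D.topNode s) ∨ s ∈ D.bag (D.topNode t) := by
  rcases D.anc_total (D.topNode_anc hs) (D.topNode_anc ht) with h | h
  · exact Or.inr (D.mem_bag_of_between hs h (D.topNode_anc ht))
  · exact Or.inl (D.mem_bag_of_between ht h (D.topNode_anc hs))

/-! ## Regions -/

/-- A bag separates its region from the other vertices. -/
theorem region_separated {i : ℕ} (h1 : 1 ≤ i) (hi : i ≤ D.len) {w x : 𝒱} {s t : V}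
    (hs : s ∈ D.region i w) (hsx : s ∈ D.bag x) (htx : t ∈ D.bag x) :
    t ∈ D.region i w ∨ t ∈ D.bag w := by
  by_cases htw : t ∈ D.bag w
  · exact Or.inr htw
  left
  rw [mem_region] at *
  obtain ⟨hs0, hw, hwL, hlow⟩ := hs
  have ha := D.topNode_anc hsx
  have hb := D.topNode_anc htx
  set a := D.topNode s
  set b := D.topNode t with hbdef
  have hbw : b ∉ D.anc w := fun h => htw (D.mem_bag_of_between htx h (D.anc_trans hw ha))
  have hwb : w ∈ D.anc b := (D.anc_total (D.anc_trans hw ha) hb).resolve_right hbw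
  -- `a` was unvisited before step `i`, and step `i` discovers only `v_i`. So a visited node below
  -- `a` can only be `a` itself.
  have hnew : ∀ u, a ∈ D.anc u → u ∈ D.thetaLE i → u = a := by
    intro u hau hu
    have haL := D.thetaLE_anc hu hau
    rw [D.eq_node_of_new h1 hi haL hs0,
      D.eq_node_of_new h1 hi hu (fun h => hs0 (D.thetaLE_anc h hau))]
  have hbL : b ∉ D.thetaLE i := by
    intro hbL
    rcases D.anc_total ha hb with h | h
    · rw [hnew b h hbL] at hbw
      exact hbw (hlow a (D.anc_refl a) (D.thetaLE_anc hbL h))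
    · exact hbw (hlow b h hbL)
  refine ⟨fun h => hbL (D.thetaLE_mono (by omega) h), hwb, hwL, fun u hu huL => ?_⟩
  rcases D.anc_total (D.anc_trans hu hb) ha with h | h
  · exact hlow u h huL
  · rw [hnew u h huL]
    exact hlow a (D.anc_refl a) (D.thetaLE_anc huL h)

theorem region_adj {i : ℕ} (h1 : 1 ≤ i) (hi : i ≤ D.len) {w : 𝒱} {s t : V}
    (hs : s ∈ D.region i w) (h : G.E s t) : t ∈ D.region i w ∨ t ∈ D.bag w := by
  obtain ⟨x, hx, hy⟩ := D.edge_mem s t h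
  exact D.region_separated h1 hi hs hx hy

/-- The vertices of `Ψ_{> i}` below the node `w`. -/
def lowerRegion (i : ℕ) (w : 𝒱) : Set V :=
  {s | D.topNode s ∉ D.thetaLE i ∧ D.IsLowest i (D.topNode s) w}

/-- Only a vertex with top node `v_i` leaves Ψ at step `i`, and the lowest visited ancestor of `v_i`
is `v_i` itself. The other regions are not affected. -/
theorem region_eq_of_ne {i : ℕ} (h1 : 1 ≤ i) (hi : i ≤ D.len) {w : 𝒱} (hw : w ≠ D.node i) :
    D.region i w = D.lowerRegion i w := by
  ext s
  rw [mem_region]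
  refine ⟨fun ⟨h0, hl⟩ => ⟨fun h => ?_, hl⟩,
    fun ⟨h0, hl⟩ => ⟨fun h => h0 (D.thetaLE_mono (by omega) h), hl⟩⟩
  have h2 := D.isLowest_unique hl (D.isLowest_self h)
  exact hw (h2.trans (D.eq_node_of_new h1 hi h h0))

theorem region_eq_of_not_critical {i : ℕ} (h1 : 1 ≤ i) (hi : i ≤ D.len) (hc : ¬ D.Critical i)
    (w : 𝒱) : D.region i w = D.lowerRegion i w := by
  ext s
  rw [mem_region]
  refine ⟨fun ⟨h0, hl⟩ => ⟨fun h => ?_, hl⟩,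
    fun ⟨h0, hl⟩ => ⟨fun h => h0 (D.thetaLE_mono (by omega) h), hl⟩⟩
  refine hc ⟨h1, hi, D.psiGT_antitone (by omega), fun hsub => ?_⟩
  exact D.mem_psiGT.1 (hsub (D.mem_psiGT.2 h0)) h

variable {D} in
theorem Critical.region_node {i : ℕ} (hc : D.Critical i) :
    D.region i (D.node i) = insert (D.newVertex i) (D.lowerRegion i (D.node i)) := by
  ext s
  rw [mem_region, Set.mem_insert_iff]
  constructor
  · rintro ⟨h0, hl⟩
    by_cases h : D.topNode s ∈ D.thetaLE i
    · exact Or.inl (D.new_unique hc.1 hc.2.1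
        ⟨D.mem_psiGT.2 h0, fun h' => D.mem_psiGT.1 h' h⟩ hc.newVertex_mem)
    · exact Or.inr ⟨h, hl⟩
  · rintro (rfl | ⟨h0, hl⟩)
    · rw [hc.topNode_eq]
      exact ⟨hc.node_notMem, D.isLowest_self (D.node_mem_thetaLE hc.1)⟩
    · exact ⟨fun h => h0 (D.thetaLE_mono (by omega) h), hl⟩

theorem bag_disjoint_lowerRegion {i : ℕ} {v w : 𝒱} (hv : v ∈ D.thetaLE i) :
    Disjoint (D.bag v) (D.lowerRegion i w) := by
  rw [Set.disjoint_left]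
  intro s hs h
  exact h.1 (D.thetaLE_anc hv (D.topNode_anc hs))

theorem region_succ_of_up {i : ℕ} (h1 : 1 ≤ i) (hi : i + 1 ≤ D.len)
    (hp : D.node (i + 1) ∈ D.anc (D.node i)) (w : 𝒱) :
    D.region (i + 1) w = D.lowerRegion i w := by
  have hL : D.thetaLE (i + 1) = D.thetaLE i := by
    refine Set.Subset.antisymm (fun v hv => ?_) (D.thetaLE_mono (by omega))
    rcases D.thetaLE_succ hi hv with h | rfl
    · exact h
    · exact D.thetaLE_anc (D.node_mem_thetaLE h1) hp
  ext s
  rw [mem_region, Nat.add_sub_cancel]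
  simp only [lowerRegion, IsLowest, hL, Set.mem_ofPred_eq]

theorem lowerRegion_of_up {i : ℕ} (h1 : 1 ≤ i) (hi : i + 1 ≤ D.len)
    (hp : D.node (i + 1) ∈ D.anc (D.node i)) : D.lowerRegion i (D.node i) = ∅ := by
  ext s
  simp only [Set.mem_empty_iff_false, iff_false]
  rintro ⟨h0, hl⟩
  exact h0 (D.mem_thetaLE_of_up h1 hi hp hl.1)

theorem mem_thetaLE_succ {i : ℕ} (hi : i + 1 ≤ D.len) (v : 𝒱) :
    v ∈ D.thetaLE (i + 1) ↔ v ∈ D.thetaLE i ∨ v = D.node (i + 1) := by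
  refine ⟨D.thetaLE_succ hi, ?_⟩
  rintro (h | rfl)
  · exact D.thetaLE_mono (by omega) h
  · exact D.node_mem_thetaLE (by omega)

/-- Descending to a child adds this single node to the visited part. The lowest visited ancestor
moves to the child for the nodes below it, and is unchanged elsewhere. -/
theorem isLowest_succ_of_down {i : ℕ} (h1 : 1 ≤ i) (hi : i + 1 ≤ D.len)
    (hd : D.node (i + 1) ∉ D.anc (D.node i)) {x w : 𝒱} :
    D.IsLowest (i + 1) x w ↔
      (w = D.node (i + 1) ∧ D.node (i + 1) ∈ D.anc x) ∨
      (D.node (i + 1) ∉ D.anc x ∧ D.IsLowest i x w) := by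
  have hL := D.mem_thetaLE_succ hi
  have hnot := D.child_not_mem_thetaLE h1 hi hd
  by_cases hx : D.node (i + 1) ∈ D.anc x
  · have hlow : D.IsLowest (i + 1) x (D.node (i + 1)) := by
      refine ⟨hx, D.node_mem_thetaLE (by omega), fun u hu huL => ?_⟩
      rcases D.anc_total hu hx with h | h
      · exact h
      · rcases (hL u).1 huL with h' | rfl
        · exact absurd (D.thetaLE_anc h' h) hnot
        · exact D.anc_refl _
    simp only [hx, and_true, not_true_eq_false, false_and, or_false]
    exact ⟨fun h => D.isLowest_unique h hlow, fun h => h ▸ hlow⟩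
  · simp only [hx, and_false, false_or, not_false_eq_true, true_and]
    have : ∀ u ∈ D.anc x, u ∈ D.thetaLE (i + 1) ↔ u ∈ D.thetaLE i := by
      intro u hu
      rw [hL]
      refine ⟨fun h => h.resolve_right ?_, Or.inl⟩
      rintro rfl
      exact hx hu
    constructor
    · rintro ⟨h2, h3, h4⟩
      exact ⟨h2, (this _ h2).1 h3, fun u hu huL => h4 u hu ((this u hu).2 huL)⟩
    · rintro ⟨h2, h3, h4⟩
      exact ⟨h2, (this _ h2).2 h3, fun u hu huL => h4 u hu ((this u hu).1 huL)⟩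

theorem isLowest_parent_of_down {i : ℕ} (h1 : 1 ≤ i) (hi : i + 1 ≤ D.len)
    (hd : D.node (i + 1) ∉ D.anc (D.node i)) {x : 𝒱} (hx : D.node (i + 1) ∈ D.anc x) :
    D.IsLowest i x (D.node i) := by
  have hadj := D.node_adj h1 hi
  have hp := D.parent_of_adj hadj hd
  have hnot := D.child_not_mem_thetaLE h1 hi hd
  refine ⟨D.anc_trans hp hx, D.node_mem_thetaLE h1, fun u hu huL => ?_⟩
  rcases D.anc_total hu hx with h | h
  · rcases D.anc_of_adj hadj h with h | rfl
    · exact h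
    · exact absurd huL hnot
  · exact absurd (D.thetaLE_anc huL h) hnot

theorem lowerRegion_node_of_down {i : ℕ} (h1 : 1 ≤ i) (hi : i + 1 ≤ D.len)
    (hd : D.node (i + 1) ∉ D.anc (D.node i)) :
    D.lowerRegion i (D.node i) =
      D.region (i + 1) (D.node i) ∪ D.region (i + 1) (D.node (i + 1)) := by
  ext s
  simp only [Set.mem_union, mem_region, Nat.add_sub_cancel, lowerRegion, Set.mem_ofPred_eq,
    D.isLowest_succ_of_down h1 hi hd]
  have hne : D.node i ≠ D.node (i + 1) := (D.node_adj h1 hi).ne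
  have h := @isLowest_parent_of_down _ _ _ _ _ D _ h1 hi hd (D.topNode s)
  have hu : D.IsLowest i (D.topNode s) (D.node (i + 1)) → False := fun hh =>
    D.child_not_mem_thetaLE h1 hi hd hh.2.1
  tauto

theorem region_succ_of_down {i : ℕ} (h1 : 1 ≤ i) (hi : i + 1 ≤ D.len)
    (hd : D.node (i + 1) ∉ D.anc (D.node i)) {w : 𝒱} (hw : w ≠ D.node i) (hw' : w ∈ D.theta i) :
    D.region (i + 1) w = D.lowerRegion i w := by
  have hne : w ≠ D.node (i + 1) := by rintro rfl; exact hd hw'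
  ext s
  simp only [mem_region, Nat.add_sub_cancel, lowerRegion, Set.mem_ofPred_eq,
    D.isLowest_succ_of_down h1 hi hd]
  have h : D.node (i + 1) ∈ D.anc (D.topNode s) → D.IsLowest i (D.topNode s) w → False :=
    fun ha hl => hw (D.isLowest_unique hl (D.isLowest_parent_of_down h1 hi hd ha))
  tauto

theorem disjoint_region_succ {i : ℕ} (h1 : 1 ≤ i) (hi : i + 1 ≤ D.len) :
    Disjoint (D.region (i + 1) (D.node i)) (D.region (i + 1) (D.node (i + 1))) := by
  rw [Set.disjoint_left]
  intro s hs ht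
  rw [mem_region] at hs ht
  exact (D.node_adj h1 hi).ne (D.isLowest_unique hs.2 ht.2)

/-- The top node of `s` is either an ancestor of `v_i`, and then `s` is in the bag of `v_i` too, or
the child, which is still unvisited at time `i`. -/
theorem bag_child_subset {i : ℕ} (h1 : 1 ≤ i) (hi : i + 1 ≤ D.len)
    (hd : D.node (i + 1) ∉ D.anc (D.node i)) {s : V} (hs : s ∈ D.bag (D.node (i + 1))) :
    s ∈ D.bag (D.node i) ∨ s ∈ D.region (i + 1) (D.node (i + 1)) := by
  have hadj := D.node_adj h1 hi
  rcases D.anc_of_adj hadj (D.topNode_anc hs) with h | h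
  · exact Or.inl (D.mem_bag_of_between hs h (D.parent_of_adj hadj hd))
  · right
    rw [mem_region, h, Nat.add_sub_cancel]
    exact ⟨D.child_not_mem_thetaLE h1 hi hd, D.isLowest_self (D.node_mem_thetaLE (by omega))⟩

theorem theta_succ_of_down {i : ℕ} (h1 : 1 ≤ i) (hi : i + 1 ≤ D.len)
    (hd : D.node (i + 1) ∉ D.anc (D.node i)) (w : 𝒱) :
    w ∈ D.theta (i + 1) ↔ w ∈ D.theta i ∨ w = D.node (i + 1) :=
  D.anc_child (D.node_adj h1 hi) (D.parent_of_adj (D.node_adj h1 hi) hd) w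

theorem theta_of_up {i : ℕ} (h1 : 1 ≤ i) (hi : i + 1 ≤ D.len)
    (hp : D.node (i + 1) ∈ D.anc (D.node i)) (w : 𝒱) :
    w ∈ D.theta i ↔ w ∈ D.theta (i + 1) ∨ w = D.node i :=
  D.anc_child (D.node_adj h1 hi).symm hp w

theorem theta_one : D.theta 1 = {D.root} := by rw [theta, node_one, anc_root]

theorem region_len [Nontrivial V] (w : 𝒱) : D.region D.len w = ∅ := by
  ext s
  simp [mem_region, thetaLE_len_pred]

theorem region_one : D.region 1 D.root = Set.univ := by
  ext s
  simp only [mem_region, Nat.sub_self, thetaLE_zero, Set.mem_empty_iff_false, not_false_eq_true,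
    true_and, Set.mem_univ, iff_true]
  refine ⟨D.root_mem_anc _, ⟨1, le_rfl, le_rfl, D.root_mem_anc _⟩, ?_⟩
  rintro u - ⟨j, h1, h2, h3⟩
  obtain rfl : j = 1 := by omega
  rwa [theta, node_one] at h3

end Traversal

section Outcomes

variable {V 𝒱 : Type*} {C : ℕ} {G : ParityGame V C} {f f' : Selector G Set.univ}

/-! ## Outcomes of `V`-selectors -/

theorem outcome_one (s : V) : outcome f s 1 = f.next s := rfl

theorem outcome_add {s t : V} {n : ℕ} (h : outcome f s n = some t) (k : ℕ) :
    outcome f s (n + k) = outcome f t k := by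
  induction k with
  | zero => exact h
  | succ k ih => rw [← add_assoc, outcome, ih, outcome]

theorem outcome_none_mono {s : V} {n m : ℕ} (h : outcome f s n = none) (hm : n ≤ m) :
    outcome f s m = none := by
  induction m, hm using Nat.le_induction with
  | base => exact h
  | succ m _ ih => rw [outcome, ih]; rfl

/-- The largest colour among the first `n` vertices of an outcome. -/
def maxColor (f : Selector G Set.univ) (s : V) (n : ℕ) : ℕ :=
  (Finset.range n).sup fun k => (outcome f s k).elim 0 G.color

theorem maxColor_one (s : V) : maxColor f s 1 = G.color s := by
  simp [maxColor, outcome]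

theorem maxColor_succ (s : V) (n : ℕ) :
    maxColor f s (n + 1) = max (maxColor f s n) ((outcome f s n).elim 0 G.color) := by
  rw [maxColor, Finset.range_add_one, Finset.sup_insert, max_comm]
  rfl

theorem maxColor_add {s t : V} {n : ℕ} (h : outcome f s n = some t) (k : ℕ) :
    maxColor f s (n + k) = max (maxColor f s n) (maxColor f t k) := by
  induction k with
  | zero => simp [maxColor]
  | succ k ih => rw [← add_assoc, maxColor_succ, ih, maxColor_succ, outcome_add h, max_assoc]

theorem one_le_maxColor (s : V) {n : ℕ} (hn : 1 ≤ n) : 1 ≤ maxColor f s n :=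
  (G.one_le_color s).trans (Finset.le_sup (f := fun k => (outcome f s k).elim 0 G.color)
    (Finset.mem_range.2 hn : 0 ∈ Finset.range n))

theorem maxColor_le (s : V) (n : ℕ) : maxColor f s n ≤ C := by
  refine Finset.sup_le fun k _ => ?_
  cases outcome f s k with
  | none => exact Nat.zero_le _
  | some t => exact G.color_le t

/-- The winning condition ignores finite prefixes: it depends only on the last vertex or on the
colours seen in the limit. -/
theorem wonByP0_shift {s t : V} {n : ℕ} (h : outcome f s n = some t) :
    WonByP0 G (outcome f s) ↔ WonByP0 G (outcome f t) := by
  have hadd : ∀ k, outcome f t k = outcome f s (k + n) := fun k => by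
    rw [add_comm, outcome_add h]
  have hsome : ∀ k ≤ n, ∃ u, outcome f s k = some u := by
    intro k hk
    by_contra hc
    have : outcome f s k = none := by
      cases hx : outcome f s k with
      | none => rfl
      | some u => exact absurd ⟨u, hx⟩ hc
    rw [outcome_none_mono this hk] at h
    cases h
  unfold WonByP0
  refine or_congr ?_ (and_congr ?_ (exists_congr fun m => and_congr_right fun _ => and_congr ?_ ?_))
  · constructor
    · rintro ⟨k, u, h1, h2, h3⟩
      have hnk : n ≤ k := by
        by_contra hc
        obtain ⟨u, hu⟩ := hsome (k + 1) (by omega)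
        rw [hu] at h2
        cases h2
      refine ⟨k - n, u, ?_, ?_, h3⟩
      · rw [hadd, Nat.sub_add_cancel hnk, h1]
      · rw [hadd, show k - n + 1 + n = k + 1 by omega, h2]
    · rintro ⟨k, u, h1, h2, h3⟩
      rw [hadd] at h1 h2
      exact ⟨k + n, u, h1, by rw [← h2]; congr 1; omega, h3⟩
  · constructor
    · intro H k
      rw [hadd]
      exact H _
    · intro H k
      rcases Nat.lt_or_ge k n with hk | hk
      · exact hsome k hk.le
      · have := H (k - n)
        rwa [hadd, Nat.sub_add_cancel hk] at this
  · simp only [hadd]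
    conv_lhs => rw [← map_add_atTop_eq_nat n, frequently_map]
  · simp only [hadd]
    conv_lhs => rw [← map_add_atTop_eq_nat n, eventually_map]

theorem wonByP0_of_next_eq_none {s : V} (h : f.next s = none) :
    WonByP0 G (outcome f s) ↔ s ∉ G.V0 := by
  have h1 : outcome f s 1 = none := h
  constructor
  · rintro (⟨n, t, hn, hn1, ht⟩ | ⟨hall, -⟩)
    · rcases Nat.eq_zero_or_pos n with rfl | hpos
      · rw [outcome, Option.some_inj] at hn
        rwa [hn]
      · rw [outcome_none_mono h1 hpos] at hn
        cases hn
    · obtain ⟨t, ht⟩ := hall 1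
      rw [h1] at ht
      cases ht
  · exact fun hs => Or.inl ⟨0, s, rfl, h1, hs⟩

/-- The outcome is periodic with period `n`. The largest colour of a period occurs infinitely often
and bounds all colours. -/
theorem wonByP0_of_loop {s : V} {n : ℕ} (hn : 1 ≤ n) (h : outcome f s n = some s) :
    WonByP0 G (outcome f s) ↔ Even (maxColor f s n) := by
  have hmul : ∀ q, outcome f s (q * n) = some s := by
    intro q
    induction q with
    | zero => simp [outcome]
    | succ q ih => rw [Nat.succ_mul, outcome_add ih, h]
  have hper : ∀ q r, outcome f s (q * n + r) = outcome f s r := fun q r => outcome_add (hmul q) r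
  have hsome : ∀ k, ∃ u, outcome f s k = some u := by
    intro k
    cases hk : outcome f s k with
    | some u => exact ⟨u, rfl⟩
    | none =>
      have := outcome_none_mono hk (Nat.le_mul_of_pos_right k hn)
      rw [hmul] at this
      cases this
  have hle : ∀ k u, outcome f s k = some u → G.color u ≤ maxColor f s n := by
    intro k u hu
    rw [← Nat.div_add_mod' k n, hper] at hu
    have := Finset.le_sup (f := fun k => (outcome f s k).elim 0 G.color)
      (Finset.mem_range.2 (Nat.mod_lt k hn))
    simpa [maxColor, hu] using this
  have hfreq : ∃ᶠ k in atTop, ∃ u, outcome f s k = some u ∧ G.color u = maxColor f s n := by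
    obtain ⟨k, -, hk⟩ := Finset.exists_mem_eq_sup (Finset.range n) ⟨0, Finset.mem_range.2 hn⟩
      fun k => (outcome f s k).elim 0 G.color
    rw [frequently_atTop]
    intro N
    obtain ⟨u, hu⟩ := hsome k
    refine ⟨N * n + k, (Nat.le_mul_of_pos_right N hn).trans (Nat.le_add_right _ _), u, ?_, ?_⟩
    · rw [hper, hu]
    · rw [maxColor, hk]
      simp [hu]
  constructor
  · rintro (⟨k, u, -, h2, -⟩ | ⟨-, m, hm, hf, he⟩)
    · obtain ⟨v, hv⟩ := hsome (k + 1)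
      rw [hv] at h2
      cases h2
    · obtain ⟨k, ⟨u, hu, hu'⟩⟩ := hf.exists
      obtain ⟨k', ⟨v, hv, hv'⟩, he'⟩ := (hfreq.and_eventually he).exists
      have h1 := hle k u hu
      have h2 := he' v hv
      have : maxColor f s n = m := by omega
      rwa [this]
  · intro hev
    exact Or.inr ⟨hsome, _, hev, hfreq, Eventually.of_forall hle⟩

/-! ## Views relative to a region -/

/-- `⊤` or `⊥` according to whether `P_0` wins or loses the outcome. -/
def resultView (f : Selector G Set.univ) (s : V) : View V :=
  if WonByP0 G (outcome f s) then View.top else View.bot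

/-- The outcome from `s` leaves `P` for the first time at step `n`, and enters `t`. -/
structure LeavesAt (P : Set V) (f : Selector G Set.univ) (s : V) (n : ℕ) (t : V) : Prop where
  pos : 1 ≤ n
  eq : outcome f s n = some t
  notMem : t ∉ P
  before : ∀ k, 1 ≤ k → k < n → ∃ x ∈ P, outcome f s k = some x

/-- The outcome from `s` stays in `P` after its first vertex. -/
def Stays (P : Set V) (f : Selector G Set.univ) (s : V) : Prop :=
  ∀ n, 1 ≤ n → ∀ t, outcome f s n = some t → t ∈ P

/-- An outcome that stops before leaving `P` counts as staying, so the two cases are exhaustive. -/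
theorem stays_or_leavesAt (P : Set V) (f : Selector G Set.univ) (s : V) :
    Stays P f s ∨ ∃ n t, LeavesAt P f s n t := by
  by_cases h : ∃ n, 1 ≤ n ∧ ∃ t, outcome f s n = some t ∧ t ∉ P
  · right
    have hspec := Nat.find_spec h
    have hmin := fun m => @Nat.find_min _ _ h m
    obtain ⟨h1, t, h2, h3⟩ := hspec
    refine ⟨Nat.find h, t, h1, h2, h3, fun k hk1 hk2 => ?_⟩
    cases hk : outcome f s k with
    | none =>
      rw [outcome_none_mono hk hk2.le] at h2
      cases h2
    | some x =>
      refine ⟨x, ?_, rfl⟩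
      by_contra hx
      exact hmin k hk2 ⟨hk1, x, hk, hx⟩
  · left
    intro n hn t ht
    by_contra hc
    exact h ⟨n, hn, t, ht, hc⟩

/-- The variant of `viewIn` for which an outcome that starts in `P` may leave `P` with its first
step. -/
def regionView (P : Set V) (f : Selector G Set.univ) (s : V) : View V :=
  if s ∉ P ∧ ∀ t, f.next s = some t → t ∉ P then View.unknown
  else if h : ∃ e : ℕ × V, LeavesAt P f s e.1 e.2 then
    View.exit h.choose.2 (maxColor f s h.choose.1)
  else resultView f s

theorem regionView_of_unknown {P : Set V} {s : V} (hs : s ∉ P)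
    (h : ∀ t, f.next s = some t → t ∉ P) : regionView P f s = View.unknown :=
  if_pos ⟨hs, h⟩

theorem LeavesAt.unique {P : Set V} {s t t' : V} {n n' : ℕ} (h : LeavesAt P f s n t)
    (h' : LeavesAt P f s n' t') : n = n' ∧ t = t' := by
  have key : ∀ {n n' : ℕ} {t t' : V}, LeavesAt P f s n t → LeavesAt P f s n' t' → ¬ n < n' := by
    intro n n' t t' h h' hlt
    obtain ⟨x, hx, hx'⟩ := h'.before n h.pos hlt
    rw [h.eq, Option.some_inj] at hx'
    exact h.notMem (hx' ▸ hx)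
  have hn : n = n' := by
    have := key h h'
    have := key h' h
    omega
  subst hn
  exact ⟨rfl, Option.some_inj.1 (h.eq.symm.trans h'.eq)⟩

theorem Stays.not_leavesAt {P : Set V} {s t : V} {n : ℕ} (h : Stays P f s) :
    ¬ LeavesAt P f s n t := fun h' => h'.notMem (h n h'.pos t h'.eq)

theorem regionView_of_leavesAt {P : Set V} {s t : V} {n : ℕ} (h : LeavesAt P f s n t)
    (hs : s ∈ P ∨ 2 ≤ n) : regionView P f s = View.exit t (maxColor f s n) := by
  rw [regionView, if_neg, dif_pos ⟨(n, t), h⟩]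
  · generalize_proofs hp
    obtain ⟨h1, h2⟩ := hp.choose_spec.unique h
    rw [h1, h2]
  · rintro ⟨hs', hnext⟩
    obtain ⟨x, hx, hx'⟩ := h.before 1 le_rfl (hs.resolve_left hs')
    exact hnext x hx' hx

theorem regionView_of_stays {P : Set V} {s : V} (h : Stays P f s)
    (hs : s ∈ P ∨ ∃ t, f.next s = some t) : regionView P f s = resultView f s := by
  rw [regionView, if_neg, dif_neg]
  · rintro ⟨e, he⟩
    exact h.not_leavesAt he
  · rintro ⟨hs', hnext⟩
    obtain ⟨t, ht⟩ := hs.resolve_left hs'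
    exact hnext t ht (h 1 le_rfl t ht)

theorem regionView_univ (s : V) : regionView Set.univ f s = resultView f s :=
  regionView_of_stays (fun _ _ _ _ => trivial) (Or.inl trivial)

/-- From θ_i, when the first step leaves the region, `viewIn` gives `?` whereas Ω_i records an exit,
as `regionView` does. The induction is therefore carried out with `regionView`; the two notions are
compared only on the whole vertex set, which no outcome leaves. -/
theorem viewIn_univ (s : V) : viewIn Set.univ f s = resultView f s := by
  simp [viewIn, resultView]

theorem regionView_empty (s : V) : regionView ∅ f s = View.unknown :=
  regionView_of_unknown (Set.notMem_empty s) fun t _ => Set.notMem_empty t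

theorem LeavesAt.mem_or_two_le {P : Set V} {s t : V} {n : ℕ} (h : LeavesAt P f s n t)
    (hs : s ∈ P ∨ ∃ x ∈ P, f.next s = some x) : s ∈ P ∨ 2 ≤ n := by
  refine hs.imp_right fun ⟨x, hx, hx'⟩ => ?_
  by_contra hn
  have h1 : n = 1 := by have := h.pos; omega
  subst h1
  rw [← outcome_one, h.eq, Option.some_inj] at hx'
  exact h.notMem (hx' ▸ hx)

/-- The view from a vertex outside of `P` is not `?` iff the first step enters `P`. -/
theorem regionView_ne_unknown {P : Set V} {s : V} :
    regionView P f s ≠ View.unknown ↔ s ∈ P ∨ ∃ t ∈ P, f.next s = some t := by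
  constructor
  · intro h
    by_contra hc
    push Not at hc
    exact h (regionView_of_unknown hc.1 fun t ht htP => hc.2 t htP ht)
  · intro hs
    rcases stays_or_leavesAt P f s with h | ⟨n, t, h⟩
    · rw [regionView_of_stays h (hs.imp_right fun ⟨t, _, ht⟩ => ⟨t, ht⟩), resultView]
      split_ifs <;> simp
    · rw [regionView_of_leavesAt h (h.mem_or_two_le hs)]
      simp

theorem outcome_congr {P : Set V} {s : V} (hP : ∀ y ∈ P, f.next y = f'.next y)
    (hs : f.next s = f'.next s) {n : ℕ}
    (hn : ∀ k, 1 ≤ k → k < n → ∀ x, outcome f s k = some x → x ∈ P) :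
    outcome f' s n = outcome f s n := by
  induction n with
  | zero => rfl
  | succ n ih =>
    have ih' := ih fun k h1 h2 => hn k h1 (by omega)
    rw [outcome, outcome, ih']
    rcases Nat.eq_zero_or_pos n with rfl | hpos
    · exact hs.symm
    · cases hx : outcome f s n with
      | none => rfl
      | some x => exact (hP x (hn n hpos (by omega) x hx)).symm

theorem maxColor_congr {s : V} {n : ℕ} (h : ∀ k < n, outcome f' s k = outcome f s k) :
    maxColor f' s n = maxColor f s n :=
  Finset.sup_congr rfl fun k hk => by rw [h k (Finset.mem_range.1 hk)]

/-- Up to its exit, an outcome consults the selector only at its start and inside `P`. From a start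
outside of `P`, a first step that misses `P` gives `?` wherever it leads, so only the edges into `P`
matter. -/
theorem regionView_congr {P : Set V} {s : V} (hP : ∀ y ∈ P, f.next y = f'.next y)
    (hs : ∀ t ∈ P, f.next s = some t ↔ f'.next s = some t) :
    regionView P f s = regionView P f' s := by
  by_cases hu : s ∈ P ∨ ∃ t ∈ P, f.next s = some t
  · have hnext : f.next s = f'.next s := by
      rcases hu with h | ⟨t, ht, h⟩
      · exact hP s h
      · rw [h, (hs t ht).1 h]
    have hu1 : s ∈ P ∨ ∃ t, f.next s = some t := hu.imp_right fun ⟨t, _, ht⟩ => ⟨t, ht⟩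
    rcases stays_or_leavesAt P f s with h | ⟨n, t, h⟩
    · have heq : outcome f' s = outcome f s := by
        funext n
        exact outcome_congr hP hnext fun k h1 _ x hx => h k h1 x hx
      have h' : Stays P f' s := by rwa [Stays, heq]
      rw [regionView_of_stays h hu1, regionView_of_stays h' (by rwa [← hnext]), resultView,
        resultView, heq]
    · have heq : ∀ k ≤ n, outcome f' s k = outcome f s k := by
        intro k hk
        refine outcome_congr hP hnext fun m h1 h2 x hx => ?_
        obtain ⟨y, hy, hy'⟩ := h.before m h1 (by omega)
        rw [hx, Option.some_inj] at hy'
        exact hy' ▸ hy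
      have h' : LeavesAt P f' s n t := by
        refine ⟨h.pos, by rw [heq n le_rfl, h.eq], h.notMem, fun k h1 h2 => ?_⟩
        rw [heq k h2.le]
        exact h.before k h1 h2
      have h2 := h.mem_or_two_le hu
      rw [regionView_of_leavesAt h h2, regionView_of_leavesAt h' h2,
        maxColor_congr fun k hk => heq k hk.le]
  · have hu' : ¬ (s ∈ P ∨ ∃ t ∈ P, f'.next s = some t) := by
      rintro (h | ⟨t, ht, h⟩)
      · exact hu (Or.inl h)
      · exact hu (Or.inr ⟨t, ht, (hs t ht).2 h⟩)
    push Not at hu hu'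
    rw [regionView_of_unknown hu.1 fun t h1 h2 => hu.2 t h2 h1,
      regionView_of_unknown hu'.1 fun t h1 h2 => hu'.2 t h2 h1]

/-- An outcome that enters the part `P` of `Q` and cannot move from `P` to `Q \ P` has the same
views in `P` and in `Q`. -/
theorem regionView_of_subset {P Q : Set V} {s t : V} (hPQ : P ⊆ Q) (hs : s ∉ Q) (ht : t ∈ P)
    (hst : f.next s = some t) (hsep : ∀ y ∈ P, ∀ z ∈ Q, f.next y = some z → z ∈ P) :
    regionView Q f s = regionView P f s := by
  have hsP : s ∉ P := fun h => hs (hPQ h)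
  rcases stays_or_leavesAt P f s with h | ⟨n, u, h⟩
  · rw [regionView_of_stays h (Or.inr ⟨t, hst⟩),
      regionView_of_stays (fun n hn x hx => hPQ (h n hn x hx)) (Or.inr ⟨t, hst⟩)]
  · have hn : 2 ≤ n := (h.mem_or_two_le (Or.inr ⟨t, ht, hst⟩)).resolve_left hsP
    -- The vertex before the exit lies in `P`, and by `hsep` the selector does not lead from there
    -- into `Q \ P`.
    have hu : u ∉ Q := by
      intro hu
      obtain ⟨x, hx, hx'⟩ := h.before (n - 1) (by omega) (by omega)
      have := h.eq
      rw [show n = n - 1 + 1 by omega, outcome, hx'] at this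
      exact h.notMem (hsep x hx u hu this)
    have h' : LeavesAt Q f s n u := ⟨h.pos, h.eq, hu, fun k h1 h2 => by
      obtain ⟨x, hx, hx'⟩ := h.before k h1 h2
      exact ⟨x, hPQ hx, hx'⟩⟩
    rw [regionView_of_leavesAt h (Or.inr hn), regionView_of_leavesAt h' (Or.inr hn)]

/-- The last vertex before leaving `P`. -/
theorem LeavesAt.exists_prev {P : Set V} {s t : V} {n : ℕ} (h : LeavesAt P f s n t)
    (hs : s ∈ P ∨ 2 ≤ n) : ∃ x ∈ P, f.next x = some t := by
  have heq := h.eq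
  obtain ⟨n, rfl⟩ : ∃ m, n = m + 1 := ⟨n - 1, by have := h.pos; omega⟩
  rw [outcome] at heq
  rcases Nat.eq_zero_or_pos n with rfl | hpos
  · exact ⟨s, hs.resolve_right (by omega), heq⟩
  · obtain ⟨x, hx, hx'⟩ := h.before n hpos (by omega)
    rw [hx'] at heq
    exact ⟨x, hx, heq⟩

/-- For a region, an edge from `P` to a vertex outside ends in the bag. This is how views are shown
to lie in Λ. -/
theorem regionView_eq_exit {P : Set V} {s t : V} {m : ℕ} (h : regionView P f s = View.exit t m) :
    (∃ x ∈ P, f.next x = some t) ∧ t ∉ P ∧ 1 ≤ m ∧ m ≤ C := by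
  have hu := regionView_ne_unknown.1 (by rw [h]; simp : regionView P f s ≠ _)
  rcases stays_or_leavesAt P f s with h' | ⟨n, u, h'⟩
  · rw [regionView_of_stays h' (hu.imp_right fun ⟨t, _, ht⟩ => ⟨t, ht⟩), resultView] at h
    split_ifs at h
  · have h2 := h'.mem_or_two_le hu
    rw [regionView_of_leavesAt h' h2, View.exit.injEq] at h
    obtain ⟨rfl, rfl⟩ := h
    exact ⟨h'.exists_prev h2, h'.notMem, one_le_maxColor s h'.pos, maxColor_le s n⟩

end Outcomes

/-- The selector with empty domain. -/
def emptySelector {V : Type*} {C : ℕ} (G : ParityGame V C) (W : Set V) : Selector G W :=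
  ⟨fun _ => none, fun _ _ h => by cases h⟩

/-! ### Local views on a bag -/

section LocalViews

variable {V 𝒱 : Type*} {C : ℕ} {G : ParityGame V C} {f f' : Selector G Set.univ}

/-- The views in `P` of a `V`-selector from the vertices of `X`. -/
def localView (X P : Set V) (f : Selector G Set.univ) : LocalView V := fun s =>
  if s ∈ X then regionView P f s else View.unknown

/-- `f` and `f'` agree on `P`, and on the edges from `X` to `P`. -/
structure AgreeOn (X P : Set V) (f f' : Selector G Set.univ) : Prop where
  inner : ∀ y ∈ P, f.next y = f'.next y
  outer : ∀ s ∈ X, ∀ t ∈ P, f.next s = some t ↔ f'.next s = some t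

theorem AgreeOn.localView_eq {X P : Set V} (h : AgreeOn X P f f') :
    localView X P f = localView X P f' := by
  funext s
  unfold localView
  split_ifs with hs
  · exact regionView_congr h.inner (h.outer s hs)
  · rfl

theorem localView_empty (X : Set V) : localView X ∅ f = allUnknown := by
  funext s
  simp [localView, allUnknown, regionView_empty]

theorem localView_of_mem {X P : Set V} {s : V} (h : s ∈ X) :
    localView X P f s = regionView P f s := if_pos h

theorem localView_of_notMem {X P : Set V} {s : V} (h : s ∉ X) :
    localView X P f s = View.unknown := if_neg h

theorem localView_ne_unknown {X P : Set V} {s : V} :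
    localView X P f s ≠ View.unknown ↔ s ∈ X ∧ (s ∈ P ∨ ∃ t ∈ P, f.next s = some t) := by
  by_cases hs : s ∈ X
  · rw [localView_of_mem hs, regionView_ne_unknown]
    simp [hs]
  · simp [localView_of_notMem hs, hs]

end LocalViews

/-! ### Admissible selectors and their views -/

namespace Traversal

variable {V 𝒱 : Type*} {C : ℕ} {G : ParityGame V C} {σ : V} (D : Traversal G 𝒱 σ)

/-- The choices of `f` at the critical index `i` are among those of the vectors `B`, `B'`. -/
def Respects (i : ℕ) (B B' : V → Set Bool) (f : Selector G Set.univ) : Prop :=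
  ∀ s ∈ D.bag (D.node i),
    (f.next (D.newVertex i) = some s → true ∈ B s) ∧
    (f.next (D.newVertex i) ≠ some s → false ∈ B s) ∧
    (f.next s = some (D.newVertex i) → true ∈ B' s) ∧
    (f.next s ≠ some (D.newVertex i) → false ∈ B' s)

/-- The `V`-selectors that respect the vectors `b` at the indices that introduce a vertex of `P`. -/
def admissible (b : ℕ → (V → Set Bool) × (V → Set Bool)) (P : Set V) :
    Set (Selector G Set.univ) :=
  {f | ∀ i, D.Critical i → D.newVertex i ∈ P → D.Respects i (b i).1 (b i).2 f}

/-- The vectors `b` are suitable and consistent with the edges of the game. -/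
def ValidVectors (b : ℕ → (V → Set Bool) × (V → Set Bool)) : Prop :=
  ∀ i, D.Critical i → D.Suitable i (b i).1 (b i).2 ∧ ∀ s ∈ D.bag (D.node i),
    (b i).1 s ∈ choice G (D.newVertex i) s ∧ (b i).2 s ∈ choice G s (D.newVertex i)

theorem edge_of_true_mem {x y : V} {B : Set Bool} (hB : B ∈ choice G x y) (h : true ∈ B) :
    G.E x y := by
  by_contra hE
  rw [choice, if_pos hE, Set.mem_singleton_iff] at hB
  rw [hB] at h
  cases h

-- The index that introduces a vertex of `P` only looks at pairs formed by this vertex and a member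
-- of its bag, and this bag lies in `P ∪ X`. The agreement of `f` and `f'` covers all these pairs.
variable {D} in
theorem admissible_congr {b : ℕ → (V → Set Bool) × (V → Set Bool)} {X P : Set V}
    {f f' : Selector G Set.univ} (hf : f' ∈ D.admissible b P) (h : AgreeOn X P f f')
    (hsep : ∀ s ∈ P, ∀ x, s ∈ D.bag x → ∀ t ∈ D.bag x, t ∈ P ∨ t ∈ X) : f ∈ D.admissible b P := by
  intro i hi hP s hs
  have h1 := hf i hi hP s hs
  have h2 : f.next s = some (D.newVertex i) ↔ f'.next s = some (D.newVertex i) := by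
    rcases hsep _ hP _ hi.newVertex_mem_bag s hs with h' | h'
    · rw [h.inner s h']
    · exact h.outer s h' _ hP
  rwa [h.inner _ hP, ne_eq (f.next s), h2]

/-- The family of the local views of admissible selectors at the nodes of `Θ_i`. -/
def admissibleViews (b : ℕ → (V → Set Bool) × (V → Set Bool)) (i : ℕ) :
    𝒱 → Set (LocalView V) := fun w =>
  if w ∈ D.theta i then
    localView (D.bag w) (D.region i w) '' D.admissible b (D.region i w)
  else ∅

theorem admissibleViews_mem_lamIdx (b : ℕ → (V → Set Bool) × (V → Set Bool)) {i : ℕ}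
    (h1 : 1 ≤ i) (hi : i ≤ D.len) : D.admissibleViews b i ∈ D.LamIdx i := by
  constructor
  · intro w hw φ hφ
    rw [admissibleViews, if_pos hw] at hφ
    obtain ⟨f, -, rfl⟩ := hφ
    refine ⟨fun s hs => localView_of_notMem hs, fun s t m h => ?_⟩
    have hs : s ∈ D.bag w := by
      by_contra hs
      rw [localView_of_notMem hs] at h
      cases h
    rw [localView_of_mem hs] at h
    obtain ⟨⟨x, hx, hxt⟩, ht, hm⟩ := regionView_eq_exit h
    exact ⟨(D.region_adj h1 hi hx (f.next_spec x t hxt).2).resolve_left ht, hm⟩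
  · intro w hw
    exact if_neg hw

/-! ## Merging two regions -/

section Merge

variable {X Y P Q : Set V} {f : Selector G Set.univ} {i : ℕ}

/-- No step of `f` leads from `P` to `Q` or back, because every exit from either one lies in `X`. So
the first step from `X` selects the part in which the outcome remains until it leaves `P ∪ Q`. -/
theorem merge_localView (hX : D.bag (D.node i) = X) (hXP : Disjoint X P) (hXQ : Disjoint X Q)
    (hP : ∀ y ∈ P, ∀ z, f.next y = some z → z ∈ P ∨ z ∈ X)
    (hQ : ∀ y ∈ Q, ∀ z, f.next y = some z → z ∈ Q ∨ z ∈ Y) (hY : ∀ s ∈ Y, s ∈ X ∨ s ∈ Q)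
    (hXY : ∀ s ∈ X, ∀ t ∈ Q, f.next s = some t → s ∈ Y) :
    localView X (P ∪ Q) f = D.merge i (localView X P f) (localView Y Q f) := by
  rw [Set.disjoint_left] at *
  funext s
  rw [merge, hX]
  by_cases hs : s ∈ X
  swap
  · rw [if_neg hs, localView_of_notMem hs]
  rw [if_pos hs, localView_of_mem hs, localView_of_mem hs]
  have hsPQ : s ∉ P ∪ Q := fun h => h.elim (hXP hs) (hXQ hs)
  by_cases h : ∃ t ∈ Q, f.next s = some t
  · obtain ⟨t, ht, hst⟩ := h
    have hsY := hXY s hs t ht hst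
    rw [if_pos (localView_ne_unknown.2 ⟨hsY, Or.inr ⟨t, ht, hst⟩⟩), localView_of_mem hsY]
    refine regionView_of_subset Set.subset_union_right hsPQ ht hst fun y hy z hz hyz => ?_
    rcases hQ y hy z hyz with h | h
    · exact h
    · rcases hY z h with h' | h'
      · exact hz.elim (fun h => absurd h (hXP h')) id
      · exact h'
  · rw [if_neg fun hne => (localView_ne_unknown.1 hne).2.elim (hXQ hs) h]
    by_cases h' : ∃ t ∈ P, f.next s = some t
    · obtain ⟨t, ht, hst⟩ := h'
      refine regionView_of_subset Set.subset_union_left hsPQ ht hst fun y hy z hz hyz => ?_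
      rcases hP y hy z hyz with h | h
      · exact h
      · exact hz.elim id fun hz => absurd hz (hXQ h)
    · rw [regionView_of_unknown hsPQ fun t ht htPQ => htPQ.elim (fun h1 => h' ⟨t, h1, ht⟩)
        (fun h1 => h ⟨t, h1, ht⟩), regionView_of_unknown (hXP hs) fun t ht h1 => h' ⟨t, h1, ht⟩]

/-- A selector that agrees with `f₁` in `P` and with `f₂` in `Q`. -/
theorem exists_glue (hXP : Disjoint X P) (hXQ : Disjoint X Q) (hPQ : Disjoint P Q)
    (f₁ f₂ : Selector G Set.univ)
    (hne : ∀ s ∈ X, (∃ t ∈ Q, f₂.next s = some t) → ¬ ∃ t ∈ P, f₁.next s = some t) :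
    ∃ f, AgreeOn X P f f₁ ∧ AgreeOn X Q f f₂ := by
  rw [Set.disjoint_left] at *
  -- Use `f₁` inside `P` and on its edges from `X` into `P`, then `f₂` likewise for `Q`, and stop
  -- elsewhere. By `hne`, no vertex of `X` is claimed by both.
  refine ⟨⟨fun s => if s ∈ P ∨ (s ∈ X ∧ ∃ t ∈ P, f₁.next s = some t) then f₁.next s
    else if s ∈ Q ∨ (s ∈ X ∧ ∃ t ∈ Q, f₂.next s = some t) then f₂.next s else none, ?_⟩,
    ⟨?_, ?_⟩, ⟨?_, ?_⟩⟩
  · intro s t h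
    split_ifs at h
    · exact f₁.next_spec s t h
    · exact f₂.next_spec s t h
  · intro y hy
    exact if_pos (Or.inl hy)
  · intro s hs t ht
    dsimp only
    have hsP : s ∉ P := hXP hs
    have hsQ : s ∉ Q := hXQ hs
    split_ifs with h1 h2
    · rfl
    · have := hne s hs (h2.resolve_left hsQ).2
      refine ⟨fun h => ?_, fun h => absurd ⟨t, ht, h⟩ this⟩
      obtain ⟨u, hu, hu'⟩ := (h2.resolve_left hsQ).2
      rw [hu', Option.some_inj] at h
      exact absurd (h ▸ hu) (hPQ ht)
    · refine ⟨fun h => (by cases h), fun h => absurd (Or.inr ⟨hs, t, ht, h⟩) h1⟩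
  · intro y hy
    dsimp only
    have hyP : y ∉ P := fun h => hPQ h hy
    have hyX : y ∉ X := fun h => hXQ h hy
    rw [if_neg (by tauto), if_pos (Or.inl hy)]
  · intro s hs t ht
    dsimp only
    have hsP : s ∉ P := hXP hs
    split_ifs with h1 h2
    · obtain ⟨u, hu, hu'⟩ := (h1.resolve_left hsP).2
      refine ⟨fun h => ?_, fun h => absurd ⟨u, hu, hu'⟩ (hne s hs ⟨t, ht, h⟩)⟩
      rw [hu', Option.some_inj] at h
      exact absurd ht (hPQ (h ▸ hu))
    · rfl
    · refine ⟨fun h => (by cases h), fun h => absurd (Or.inr ⟨hs, t, ht, h⟩) h2⟩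

end Merge

theorem admissible_union {b : ℕ → (V → Set Bool) × (V → Set Bool)} {P Q : Set V} :
    D.admissible b (P ∪ Q) = D.admissible b P ∩ D.admissible b Q := by
  ext f
  constructor
  · exact fun h => ⟨fun i hi hP => h i hi (Or.inl hP), fun i hi hP => h i hi (Or.inr hP)⟩
  · exact fun h i hi hP => hP.elim (h.1 i hi) (h.2 i hi)

/-- If the tour goes up from `v_i`, everything below has been visited: the lower region is empty and
its only view is constantly `?`. If it goes down, the lower region is the union of two regions of
level `i + 1`, whose compatible views are exactly those that come from one glued selector. At the
other nodes of Θ_i nothing changes. -/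
theorem omegaStar_admissibleViews (b : ℕ → (V → Set Bool) × (V → Set Bool)) {i : ℕ}
    (h1 : 1 ≤ i) (hi : i + 1 ≤ D.len) (w : 𝒱) (hw : w ∈ D.theta i) :
    D.omegaStar i (D.admissibleViews b (i + 1)) w =
      localView (D.bag w) (D.lowerRegion i w) '' D.admissible b (D.lowerRegion i w) := by
  rw [omegaStar, if_neg (not_not.2 hw)]
  by_cases hp : D.node (i + 1) ∈ D.anc (D.node i)
  · by_cases hwi : w = D.node i
    · subst hwi
      rw [if_neg (not_not.2 rfl), if_pos hp, D.lowerRegion_of_up h1 hi hp]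
      ext φ
      constructor
      · rintro rfl
        exact ⟨emptySelector G _, fun i _ h => absurd h (Set.notMem_empty _), localView_empty _⟩
      · rintro ⟨f, -, rfl⟩
        exact localView_empty _
    · rw [if_pos hwi, admissibleViews, if_pos (((D.theta_of_up h1 hi hp w).1 hw).resolve_right hwi),
        D.region_succ_of_up h1 hi hp]
  · by_cases hwi : w = D.node i
    · subst hwi
      rw [if_neg (not_not.2 rfl), if_neg hp, D.lowerRegion_node_of_down h1 hi hp, admissibleViews,
        if_pos ((D.theta_succ_of_down h1 hi hp _).2 (Or.inl hw)), admissibleViews,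
        if_pos ((D.theta_succ_of_down h1 hi hp _).2 (Or.inr rfl))]
      have hX : Disjoint (D.bag (D.node i)) (D.lowerRegion i (D.node i)) :=
        D.bag_disjoint_lowerRegion (D.node_mem_thetaLE h1)
      rw [D.lowerRegion_node_of_down h1 hi hp, Set.disjoint_union_right] at hX
      have hPQ := D.disjoint_region_succ h1 hi
      have hsP : ∀ s ∈ D.region (i + 1) (D.node i), ∀ x, s ∈ D.bag x → ∀ t ∈ D.bag x,
          t ∈ D.region (i + 1) (D.node i) ∨ t ∈ D.bag (D.node i) :=
        fun s hs x hx t ht => D.region_separated (by omega) hi hs hx ht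
      have hsQ : ∀ s ∈ D.region (i + 1) (D.node (i + 1)), ∀ x, s ∈ D.bag x → ∀ t ∈ D.bag x,
          t ∈ D.region (i + 1) (D.node (i + 1)) ∨ t ∈ D.bag (D.node (i + 1)) :=
        fun s hs x hx t ht => D.region_separated (by omega) hi hs hx ht
      have hY : ∀ s ∈ D.bag (D.node (i + 1)),
          s ∈ D.bag (D.node i) ∨ s ∈ D.region (i + 1) (D.node (i + 1)) :=
        fun s hs => D.bag_child_subset h1 hi hp hs
      set X := D.bag (D.node i) with hXdef
      set Y := D.bag (D.node (i + 1))
      set P := D.region (i + 1) (D.node i)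
      set Q := D.region (i + 1) (D.node (i + 1))
      have hXY : ∀ f : Selector G Set.univ, ∀ s ∈ X, ∀ t ∈ Q, f.next s = some t → s ∈ Y := by
        intro f s hs t ht hst
        obtain ⟨x, hx, hx'⟩ := D.edge_mem s t (f.next_spec s t hst).2
        exact (hsQ t ht x hx' s hx).resolve_left (Set.disjoint_left.1 hX.2 hs)
      have hmerge : ∀ f : Selector G Set.univ,
          localView X (P ∪ Q) f = D.merge i (localView X P f) (localView Y Q f) := by
        intro f
        refine D.merge_localView rfl hX.1 hX.2 (fun y hy z hz => ?_) (fun y hy z hz => ?_)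
          hY (hXY f)
        · obtain ⟨x, hx, hx'⟩ := D.edge_mem y z (f.next_spec y z hz).2
          exact hsP y hy x hx z hx'
        · obtain ⟨x, hx, hx'⟩ := D.edge_mem y z (f.next_spec y z hz).2
          exact hsQ y hy x hx z hx'
      rw [admissible_union]
      ext φ
      constructor
      · rintro ⟨_, ⟨f₁, hf₁, rfl⟩, _, ⟨f₂, hf₂, rfl⟩, hun, -, rfl⟩
        -- Compatibility of the views means that no vertex of the common bag steps into `P` under
        -- `f₁` and into `Q` under `f₂`.
        obtain ⟨f, hP, hQ⟩ := exists_glue hX.1 hX.2 hPQ f₁ f₂ (by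
          rintro s hs ⟨t, ht, hst⟩ ht'
          have hsY := hXY f₂ s hs t ht hst
          rcases hun s ⟨hs, hsY⟩ with h | h
          · exact localView_ne_unknown.2 ⟨hs, Or.inr ht'⟩ h
          · exact localView_ne_unknown.2 ⟨hsY, Or.inr ⟨t, ht, hst⟩⟩ h)
        have hQY : AgreeOn Y Q f f₂ := ⟨hQ.inner, fun s hs t ht => by
          rcases hY s hs with h | h
          · exact hQ.outer s h t ht
          · rw [hQ.inner s h]⟩
        refine ⟨f, ⟨admissible_congr hf₁ hP hsP, admissible_congr hf₂ hQY hsQ⟩, ?_⟩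
        rw [hmerge, hP.localView_eq, hQY.localView_eq]
      · rintro ⟨f, ⟨hfP, hfQ⟩, rfl⟩
        refine ⟨_, ⟨f, hfP, rfl⟩, _, ⟨f, hfQ, rfl⟩, ?_, ?_, hmerge f⟩
        · rintro s ⟨hs, -⟩
          by_contra! hc
          obtain ⟨t, ht, hst⟩ := (localView_ne_unknown.1 hc.1).2.resolve_left
            (Set.disjoint_left.1 hX.1 hs)
          obtain ⟨u, hu, hsu⟩ := (localView_ne_unknown.1 hc.2).2.resolve_left
            (Set.disjoint_left.1 hX.2 hs)
          rw [hst, Option.some_inj] at hsu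
          exact Set.disjoint_left.1 hPQ ht (hsu ▸ hu)
        -- An exit from the child's region is in the child's bag. Not being in the region, it is in
        -- the bag of the parent.
        · intro s t m hst
          have hs := (localView_ne_unknown (s := s).1 (by rw [hst]; simp)).1
          rw [localView_of_mem hs] at hst
          obtain ⟨⟨x, hx, hxt⟩, ht, -⟩ := regionView_eq_exit hst
          obtain ⟨z, hz, hz'⟩ := D.edge_mem x t (f.next_spec x t hxt).2
          exact (hY t ((hsQ x hx z hz t hz').resolve_left ht)).resolve_right ht
    · rw [if_pos hwi, admissibleViews, if_pos ((D.theta_succ_of_down h1 hi hp w).2 (Or.inl hw)),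
        D.region_succ_of_down h1 hi hp hwi hw]

end Traversal

/-! ### Enlarging a region by one vertex -/

section Insert

variable {V 𝒱 : Type*} {C : ℕ} {G : ParityGame V C} {f : Selector G Set.univ} {P : Set V}

theorem resultView_congr {s t : V} (h : WonByP0 G (outcome f s) ↔ WonByP0 G (outcome f t)) :
    resultView f s = resultView f t := by
  rw [resultView, resultView, if_congr h rfl rfl]

theorem resultView_eq_of_outcome {s t : V} {n : ℕ} (h : outcome f s n = some t) :
    resultView f s = resultView f t := resultView_congr (wonByP0_shift h)

theorem Stays.of_next_eq_none {s : V} (h : f.next s = none) : Stays P f s := by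
  intro n hn t ht
  rw [outcome_none_mono (show outcome f s 1 = none from h) hn] at ht
  cases ht

theorem Stays.mono {Q : Set V} {s : V} (h : Stays P f s) (hPQ : P ⊆ Q) : Stays Q f s :=
  fun n hn t ht => hPQ (h n hn t ht)

theorem LeavesAt.insert {s t u : V} {n : ℕ} (h : LeavesAt P f s n t) (ht : t ≠ u) :
    LeavesAt (insert u P) f s n t :=
  ⟨h.pos, h.eq, by simp [ht, h.notMem], fun k h1 h2 => by
    obtain ⟨x, hx, hx'⟩ := h.before k h1 h2
    exact ⟨x, Or.inr hx, hx'⟩⟩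

theorem LeavesAt.trans_insert {s t u : V} {n m : ℕ} (h : LeavesAt P f s n u)
    (h' : LeavesAt (Insert.insert u P) f u m t) :
    LeavesAt (Insert.insert u P) f s (n + m) t := by
  refine ⟨by have := h.pos; omega, by rw [outcome_add h.eq, h'.eq], h'.notMem, fun k h1 h2 => ?_⟩
  rcases lt_trichotomy k n with hk | rfl | hk
  · obtain ⟨x, hx, hx'⟩ := h.before k h1 hk
    exact ⟨x, Or.inr hx, hx'⟩
  · exact ⟨u, Or.inl rfl, h.eq⟩
  · obtain ⟨j, rfl⟩ := Nat.exists_eq_add_of_lt hk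
    rw [add_assoc, outcome_add h.eq]
    exact h'.before (j + 1) (by omega) (by omega)

theorem LeavesAt.stays_insert {s u : V} {n : ℕ} (h : LeavesAt P f s n u)
    (h' : Stays (Insert.insert u P) f u) : Stays (Insert.insert u P) f s := by
  intro k h1 t ht
  rcases lt_trichotomy k n with hk | rfl | hk
  · obtain ⟨x, hx, hx'⟩ := h.before k h1 hk
    rw [ht, Option.some_inj] at hx'
    exact Or.inr (hx' ▸ hx)
  · rw [h.eq, Option.some_inj] at ht
    exact Or.inl ht.symm
  · obtain ⟨j, rfl⟩ := Nat.exists_eq_add_of_lt hk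
    rw [add_assoc, outcome_add h.eq] at ht
    exact h' _ (by omega) t ht

/-- The outcome repeats its first `n` steps forever, and these visit only `P` and `u`. -/
theorem LeavesAt.stays_of_loop {u : V} {n : ℕ} (h : LeavesAt P f u n u) :
    Stays (Insert.insert u P) f u := by
  have hpos := h.pos
  have hmul : ∀ q, outcome f u (q * n) = some u := by
    intro q
    induction q with
    | zero => simp [outcome]
    | succ q ih => rw [Nat.succ_mul, outcome_add ih, h.eq]
  intro k _ t ht
  rw [← Nat.div_add_mod' k n, outcome_add (hmul _)] at ht
  rcases Nat.eq_zero_or_pos (k % n) with h0 | h0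
  · rw [h0, outcome, Option.some_inj] at ht
    exact Or.inl ht.symm
  · obtain ⟨x, hx, hx'⟩ := h.before _ h0 (Nat.mod_lt _ hpos)
    rw [ht, Option.some_inj] at hx'
    exact Or.inr (hx' ▸ hx)

end Insert

namespace Traversal

variable {V 𝒱 : Type*} {C : ℕ} {G : ParityGame V C} {σ : V} (D : Traversal G 𝒱 σ)
  {X P : Set V} {f : Selector G Set.univ} {i : ℕ} {θ : V}

theorem setEdges_singleton {φ : LocalView V} {S T : Set V} {s : V} (hS : S = {s}) :
    D.setEdges i φ S T (D.newVertex i) = View.exit s (G.color (D.newVertex i)) := by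
  have h : D.newVertex i = D.newVertex i ∧ ∃ s, S = {s} := ⟨rfl, s, hS⟩
  rw [setEdges, dif_pos h]
  congr
  exact Set.singleton_injective (h.2.choose_spec.symm.trans hS)

theorem setEdges_of_not_singleton {φ : LocalView V} {S T : Set V} {x : V}
    (hx : ¬ (x = D.newVertex i ∧ ∃ s, S = {s})) :
    D.setEdges i φ S T x = if x ∈ T then View.exit (D.newVertex i) (G.color x) else φ x := by
  rw [setEdges, dif_neg hx]

theorem resolve_newVertex (φ : LocalView V) :
    D.resolve i φ (D.newVertex i) = D.resolveNew i φ := if_pos rfl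

/-- What the edges `S`, `T` of `f` add to its local view in `P`. -/
theorem setEdges_localView_new (hθ : D.newVertex i = θ) (hXP : Disjoint X P)
    (hθX : θ ∈ X)
    (hsep : ∀ t, f.next θ = some t → t ∈ P ∨ t ∈ X) :
    (f.next θ = none ∧
      D.setEdges i (localView X P f) {s | s ∈ X ∧ f.next θ = some s}
        {s | s ∈ X ∧ f.next s = some θ} θ = View.unknown) ∨
    (∃ n t, LeavesAt P f θ n t ∧
      D.setEdges i (localView X P f) {s | s ∈ X ∧ f.next θ = some s}
        {s | s ∈ X ∧ f.next s = some θ} θ = View.exit t (maxColor f θ n)) ∨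
    (Stays P f θ ∧
      D.setEdges i (localView X P f) {s | s ∈ X ∧ f.next θ = some s}
        {s | s ∈ X ∧ f.next s = some θ} θ = resultView f θ) := by
  subst hθ
  have hθP : D.newVertex i ∉ P := Set.disjoint_left.1 hXP hθX
  -- Either the first step from θ goes to the bag, possibly to θ itself, and `setEdges` records this
  -- exit with colour c(θ); or the view in `P` is already correct.
  by_cases hS : ∃ s ∈ X, f.next (D.newVertex i) = some s
  · obtain ⟨s, hsX, hs⟩ := hS
    refine Or.inr (Or.inl ⟨1, s, ⟨le_rfl, hs, Set.disjoint_left.1 hXP hsX, by omega⟩, ?_⟩)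
    rw [D.setEdges_singleton (s := s), maxColor_one]
    ext x
    simp only [Set.mem_ofPred_eq, Set.mem_singleton_iff, hs, Option.some_inj]
    exact ⟨fun h => h.2.symm, fun h => ⟨h ▸ hsX, h.symm⟩⟩
  · have hval : D.setEdges i (localView X P f) {s | s ∈ X ∧ f.next (D.newVertex i) = some s}
        {s | s ∈ X ∧ f.next s = some (D.newVertex i)} (D.newVertex i) =
        regionView P f (D.newVertex i) := by
      rw [D.setEdges_of_not_singleton, if_neg, localView_of_mem hθX]
      · exact fun h => hS ⟨_, h⟩
      · rintro ⟨-, s, h⟩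
        exact hS ⟨s, h.symm.subset rfl⟩
    rw [hval]
    cases hnext : f.next (D.newVertex i) with
    | none =>
      exact Or.inl ⟨rfl, regionView_of_unknown hθP fun t ht => by rw [hnext] at ht; cases ht⟩
    | some t =>
      have htP : t ∈ P := (hsep t hnext).resolve_right fun h => hS ⟨t, h, hnext⟩
      right
      rcases stays_or_leavesAt P f (D.newVertex i) with h | ⟨n, u, h⟩
      · exact Or.inr ⟨h, regionView_of_stays h (Or.inr ⟨t, hnext⟩)⟩
      · exact Or.inl ⟨n, u, h, regionView_of_leavesAt h
          (h.mem_or_two_le (Or.inr ⟨t, htP, hnext⟩))⟩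

/-- Without a successor, the owner of θ loses. An exit to θ closes a cycle, decided by the parity of
its largest colour. Any other exit leaves the larger region too, and an outcome that stays in `P` is
already decided. -/
theorem resolveNew_localView (hθ : D.newVertex i = θ) (hXP : Disjoint X P)
    (hθX : θ ∈ X)
    (hsep : ∀ t, f.next θ = some t → t ∈ P ∨ t ∈ X) :
    (∃ n t, LeavesAt (insert θ P) f θ n t ∧
      D.resolveNew i (D.setEdges i (localView X P f) {s | s ∈ X ∧ f.next θ = some s}
        {s | s ∈ X ∧ f.next s = some θ}) = View.exit t (maxColor f θ n)) ∨
    (Stays (insert θ P) f θ ∧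
      D.resolveNew i (D.setEdges i (localView X P f) {s | s ∈ X ∧ f.next θ = some s}
        {s | s ∈ X ∧ f.next s = some θ}) = resultView f θ) := by
  have h := D.setEdges_localView_new hθ hXP hθX hsep
  set ψ := D.setEdges i (localView X P f) {s | s ∈ X ∧ f.next θ = some s}
    {s | s ∈ X ∧ f.next s = some θ}
  rw [resolveNew, hθ]
  rcases h with ⟨h, hψ⟩ | ⟨n, t, h, hψ⟩ | ⟨h, hψ⟩
  · right
    refine ⟨Stays.of_next_eq_none h, ?_⟩
    rw [hψ, resultView, wonByP0_of_next_eq_none h]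
    dsimp only
    split_ifs <;> simp_all
  · by_cases ht : t = θ
    · subst ht
      right
      refine ⟨h.stays_of_loop, ?_⟩
      rw [hψ, resultView, wonByP0_of_loop h.pos h.eq]
      simp
    · left
      refine ⟨n, t, h.insert ht, ?_⟩
      rw [hψ]
      simp [ht]
  · right
    refine ⟨h.mono (Set.subset_insert _ _), ?_⟩
    rw [hψ, resultView]
    split_ifs <;> rfl

/-- Adding the edges `S`, `T` of `f` to its local view in `P` yields its local view in the larger
region `P ∪ {θ}`. -/
theorem resolve_localView (hθ : D.newVertex i = θ) (hXP : Disjoint X P)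
    (hθX : θ ∈ X)
    (hsep : ∀ t, f.next θ = some t → t ∈ P ∨ t ∈ X) :
    D.resolve i (D.setEdges i (localView X P f) {s | s ∈ X ∧ f.next θ = some s}
      {s | s ∈ X ∧ f.next s = some θ}) = localView X (insert θ P) f := by
  have h := D.resolveNew_localView hθ hXP hθX hsep
  have hψ : ∀ x, x ≠ θ → D.setEdges i (localView X P f) {s | s ∈ X ∧ f.next θ = some s}
      {s | s ∈ X ∧ f.next s = some θ} x =
      if x ∈ X ∧ f.next x = some θ then View.exit θ (G.color x) else localView X P f x := by
    intro x hx
    rw [D.setEdges_of_not_singleton (fun h => hx (h.1.trans hθ)), hθ]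
    by_cases hc : x ∈ X ∧ f.next x = some θ
    · exact (if_pos hc).trans (if_pos hc).symm
    · exact (if_neg hc).trans (if_neg hc).symm
  set ψ := D.setEdges i (localView X P f) {s | s ∈ X ∧ f.next θ = some s}
    {s | s ∈ X ∧ f.next s = some θ}
  have hθP : θ ∉ P := Set.disjoint_left.1 hXP hθX
  funext x
  by_cases hxθ : x = θ
  · subst hxθ
    rw [localView_of_mem hθX]
    have := D.resolve_newVertex (i := i) ψ
    rw [hθ] at this
    rw [this]
    rcases h with ⟨n, t, h, h'⟩ | ⟨h, h'⟩
    · rw [h', regionView_of_leavesAt h (Or.inl (Or.inl rfl))]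
    · rw [h', regionView_of_stays h (Or.inl (Or.inl rfl))]
  rw [resolve, if_neg (by rwa [hθ]), hψ x hxθ, hθ]
  by_cases hxX : x ∈ X
  swap
  · rw [if_neg (fun h => hxX h.1), localView_of_notMem hxX, localView_of_notMem hxX]
  have hxP : x ∉ P := Set.disjoint_left.1 hXP hxX
  have hxP' : x ∉ insert θ P := by simp [hxθ, hxP]
  rw [localView_of_mem hxX, localView_of_mem hxX]
  rcases stays_or_leavesAt P f x with hs | ⟨n, t, hl⟩
  · have hne : f.next x ≠ some θ := fun he => hθP (hs 1 le_rfl θ he)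
    rw [if_neg (fun h => hne h.2)]
    by_cases hnone : ∃ t, f.next x = some t
    · rw [regionView_of_stays hs (Or.inr hnone),
        regionView_of_stays (hs.mono (Set.subset_insert _ _)) (Or.inr hnone), resultView]
      split_ifs <;> rfl
    · rw [regionView_of_unknown hxP (fun t ht => absurd ⟨t, ht⟩ hnone),
        regionView_of_unknown hxP' (fun t ht => absurd ⟨t, ht⟩ hnone)]
  · by_cases ht : t = θ
    · subst ht
      -- After one step, the exit to θ (now called `t`) is recorded by `T` with colour c(x); after
      -- more steps, it is part of the view in `P`. Both have the same form.
      have hval : (if x ∈ X ∧ f.next x = some t then View.exit t (G.color x)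
          else regionView P f x) = View.exit t (maxColor f x n) := by
        split_ifs with hc
        · have h1 : LeavesAt P f x 1 t := ⟨le_rfl, hc.2, hθP, by omega⟩
          rw [(hl.unique h1).1, maxColor_one]
        · refine regionView_of_leavesAt hl (Or.inr ?_)
          by_contra hn
          have h1 : n = 1 := by have := hl.pos; omega
          subst h1
          exact hc ⟨hxX, hl.eq⟩
      have hin : ∃ u, f.next x = some u := by
        cases hx : f.next x with
        | some u => exact ⟨u, rfl⟩
        | none =>
          have := hl.eq
          rw [outcome_none_mono (show outcome f x 1 = none from hx) hl.pos] at this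
          cases this
      rw [hval]
      dsimp only
      rw [if_pos rfl]
      -- Continue with the outcome from θ: an exit yields the maximum of both colours, and an
      -- outcome that stays has the winner of its tail.
      rcases h with ⟨m, u, h, h'⟩ | ⟨h, h'⟩
      · rw [h', regionView_of_leavesAt (hl.trans_insert h)
          (Or.inr (by have := hl.pos; have := h.pos; omega)), maxColor_add hl.eq]
      · rw [h', regionView_of_stays (hl.stays_insert h) (Or.inr hin),
          resultView_eq_of_outcome hl.eq, resultView]
        split_ifs <;> rfl
    · have hne : ¬ (x ∈ X ∧ f.next x = some θ) := by
        rintro ⟨-, hc⟩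
        exact ht (hl.unique (⟨le_rfl, hc, hθP, by omega⟩ : LeavesAt P f x 1 θ)).2
      rw [if_neg hne]
      by_cases hn : 2 ≤ n
      · rw [regionView_of_leavesAt hl (Or.inr hn), regionView_of_leavesAt (hl.insert ht) (Or.inr hn)]
        dsimp only
        rw [if_neg ht]
      · have h1 : n = 1 := by have := hl.pos; omega
        subst h1
        have heq : f.next x = some t := hl.eq
        rw [regionView_of_unknown hxP (fun u hu => ?_), regionView_of_unknown hxP' (fun u hu => ?_)]
        · rw [heq, Option.some_inj] at hu
          rw [← hu]
          exact (hl.insert ht).notMem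
        · rw [heq, Option.some_inj] at hu
          rw [← hu]
          exact hl.notMem

/-- A selector that uses the edges `S`, `T` and agrees with `f₀` in `P`. -/
theorem exists_setEdges {θ : V} {X P S T : Set V} (hXP : Disjoint X P) (hθX : θ ∈ X)
    (f₀ : Selector G Set.univ) (hSX : S ⊆ X) (hTX : T ⊆ X) (hS : S.Subsingleton)
    (hST : S = {θ} ↔ θ ∈ T) (hSE : ∀ s ∈ S, G.E θ s) (hTE : ∀ s ∈ T, G.E s θ)
    (hSP : ∀ t ∈ P, f₀.next θ = some t → S = ∅)
    (hTP : ∀ s ∈ T, ∀ t ∈ P, f₀.next s ≠ some t) :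
    ∃ f : Selector G Set.univ, AgreeOn X P f f₀ ∧ S = {s | s ∈ X ∧ f.next θ = some s} ∧
      T = {s | s ∈ X ∧ f.next s = some θ} := by
  rw [Set.disjoint_left] at hXP
  have hθP := hXP hθX
  have hP : ∀ x, x ∈ P ∨ (x ∈ X ∧ ∃ t ∈ P, f₀.next x = some t) → ¬ (x = θ ∧ S.Nonempty) ∧ x ∉ T := by
    rintro x (h | ⟨hx, t, ht, h⟩)
    · exact ⟨fun hc => hθP (hc.1 ▸ h), fun hc => hXP (hTX hc) h⟩
    · refine ⟨?_, fun hc => hTP x hc t ht h⟩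
      rintro ⟨rfl, hne⟩
      exact hne.ne_empty (hSP t ht h)
  -- Steps of `f₀` inside or into `P` have priority; then θ takes its edge in `S`, and the vertices
  -- of `T` move to θ. There is no conflict by `hP`, and by `hST` for a loop at θ.
  let next : V → Option V := fun x =>
    if x ∈ P ∨ (x ∈ X ∧ ∃ t ∈ P, f₀.next x = some t) then f₀.next x
    else if h : x = θ ∧ S.Nonempty then some h.2.some
    else if x ∈ T then some θ else none
  have h1 : ∀ x, x ∈ P ∨ (x ∈ X ∧ ∃ t ∈ P, f₀.next x = some t) → next x = f₀.next x :=
    fun x hx => if_pos hx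
  have h2 : ∀ s ∈ S, next θ = some s := by
    intro s hs
    have hc : θ = θ ∧ S.Nonempty := ⟨rfl, s, hs⟩
    have hn : ¬ (θ ∈ P ∨ (θ ∈ X ∧ ∃ t ∈ P, f₀.next θ = some t)) := fun h => (hP θ h).1 hc
    change (if _ then _ else if h : _ then _ else _) = _
    rw [if_neg hn, dif_pos hc, hS hc.2.some_mem hs]
  have h3 : ∀ x ∈ T, next x = some θ := by
    intro x hx
    by_cases hc : x = θ
    · subst hc
      exact h2 x ((hST.2 hx).symm.subset rfl)
    · have hn : ¬ (x ∈ P ∨ (x ∈ X ∧ ∃ t ∈ P, f₀.next x = some t)) := fun h => (hP x h).2 hx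
      change (if _ then _ else if h : _ then _ else _) = _
      rw [if_neg hn, dif_neg fun h => hc h.1, if_pos hx]
  have h4 : ∀ x t, next x = some t →
      ((x ∈ P ∨ (x ∈ X ∧ ∃ t ∈ P, f₀.next x = some t)) ∧ f₀.next x = some t) ∨
      (x = θ ∧ t ∈ S) ∨ (x ∈ T ∧ t = θ) := by
    intro x t h
    change (if _ then _ else if h : _ then _ else _) = _ at h
    split_ifs at h with a b c
    · exact Or.inl ⟨a, h⟩
    · exact Or.inr (Or.inl ⟨b.1, Option.some_inj.1 h ▸ b.2.some_mem⟩)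
    · exact Or.inr (Or.inr ⟨c, (Option.some_inj.1 h).symm⟩)
  have h5 : ∀ x ∈ X, ∀ t ∈ X, next x = some t → (x = θ ∧ t ∈ S) ∨ (x ∈ T ∧ t = θ) := by
    intro x hx t ht h
    refine (h4 x t h).resolve_left ?_
    rintro ⟨h | ⟨-, u, hu, h⟩, h'⟩
    · exact hXP hx h
    · rw [h, Option.some_inj] at h'
      exact hXP ht (h' ▸ hu)
  refine ⟨⟨next, fun s t h => ⟨trivial, ?_⟩⟩, ⟨fun y hy => h1 y (Or.inl hy), fun s hs t ht => ?_⟩,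
    ?_, ?_⟩
  · rcases h4 s t h with ⟨-, h'⟩ | ⟨rfl, h'⟩ | ⟨h', rfl⟩
    · exact (f₀.next_spec s t h').2
    · exact hSE t h'
    · exact hTE s h'
  · constructor
    · intro h
      rcases h4 s t h with ⟨-, h'⟩ | ⟨rfl, h'⟩ | ⟨h', rfl⟩
      · exact h'
      · exact absurd ht (hXP (hSX h'))
      · exact absurd ht hθP
    · intro h
      exact (h1 s (Or.inr ⟨hs, t, ht, h⟩)).trans h
  · ext s
    refine ⟨fun h => ⟨hSX h, h2 s h⟩, fun ⟨hs, h⟩ => ?_⟩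
    rcases h5 θ hθX s hs h with h | ⟨h, rfl⟩
    · exact h.2
    · exact (hST.2 h).symm.subset rfl
  · ext s
    refine ⟨fun h => ⟨hTX h, h3 s h⟩, fun ⟨hs, h⟩ => ?_⟩
    rcases h5 s hs θ hθX h with ⟨rfl, h⟩ | h
    · refine hST.1 (Set.Subset.antisymm (fun x hx => hS hx h) ?_)
      rintro x rfl
      exact h
    · exact h.1

theorem admissible_insert {b : ℕ → (V → Set Bool) × (V → Set Bool)} {P : Set V} {i : ℕ}
    (hi : D.Critical i) {f : Selector G Set.univ} :
    f ∈ D.admissible b (insert (D.newVertex i) P) ↔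
      D.Respects i (b i).1 (b i).2 f ∧ f ∈ D.admissible b P := by
  constructor
  · exact fun h => ⟨h i hi (Or.inl rfl), fun j hj hP => h j hj (Or.inr hP)⟩
  · rintro ⟨h1, h2⟩ j hj (h | h)
    · rwa [hj.eq_of_node_eq hi h]
    · exact h2 j hj h

/-- An adapted triple (φ, S, T) is the trace of a selector: φ is its view in the lower region, `S`
the step from θ into the bag, `T` the set of vertices of the bag that step to θ. The conditions on
the vectors then say that the selector respects them, and `resolve_localView` computes its view. -/
theorem omegaCrit_admissibleViews [Nontrivial V] {b : ℕ → (V → Set Bool) × (V → Set Bool)}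
    (hb : D.ValidVectors b) {i : ℕ} (hc : D.Critical i) :
    D.omegaCrit i (D.admissibleViews b (i + 1)) (b i).1 (b i).2 = D.admissibleViews b i := by
  have h1 := hc.1
  have hi := hc.lt_len
  have hstar := D.omegaStar_admissibleViews b h1 hi
  funext w
  by_cases hw : w ∈ D.theta i
  swap
  · have hne : w ≠ D.node i := fun h => hw (h ▸ D.node_mem_theta i)
    rw [omegaCrit, if_neg hne, omegaStar, if_pos hw, admissibleViews, if_neg hw]
  by_cases hwi : w = D.node i
  swap
  · rw [omegaCrit, if_neg hwi, hstar w hw, admissibleViews, if_pos hw,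
      D.region_eq_of_ne h1 (by omega) hwi]
  subst hwi
  rw [omegaCrit, if_pos rfl, hstar _ hw, admissibleViews, if_pos hw, hc.region_node]
  have hXP : Disjoint (D.bag (D.node i)) (D.lowerRegion i (D.node i)) :=
    D.bag_disjoint_lowerRegion (D.node_mem_thetaLE h1)
  have hθX := hc.newVertex_mem_bag
  have hsep : ∀ s ∈ insert (D.newVertex i) (D.lowerRegion i (D.node i)), ∀ x, s ∈ D.bag x →
      ∀ t ∈ D.bag x, t ∈ insert (D.newVertex i) (D.lowerRegion i (D.node i)) ∨
        t ∈ D.bag (D.node i) := by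
    rw [← hc.region_node]
    exact fun s hs x hx t ht => D.region_separated h1 (by omega) hs hx ht
  have hsep' : ∀ s ∈ insert (D.newVertex i) (D.lowerRegion i (D.node i)), ∀ x, s ∈ D.bag x →
      ∀ t ∈ D.bag x, t ∈ D.lowerRegion i (D.node i) ∨ t ∈ D.bag (D.node i) := by
    intro s hs x hx t ht
    rcases hsep s hs x hx t ht with (rfl | h) | h
    · exact Or.inr hθX
    · exact Or.inl h
    · exact Or.inr h
  have hresolve : ∀ f : Selector G Set.univ, D.resolve i
      (D.setEdges i (localView (D.bag (D.node i)) (D.lowerRegion i (D.node i)) f)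
        {s | s ∈ D.bag (D.node i) ∧ f.next (D.newVertex i) = some s}
        {s | s ∈ D.bag (D.node i) ∧ f.next s = some (D.newVertex i)}) =
      localView (D.bag (D.node i)) (insert (D.newVertex i) (D.lowerRegion i (D.node i))) f := by
    refine fun f => D.resolve_localView rfl hXP hθX fun t ht => ?_
    obtain ⟨x, hx, hx'⟩ := D.edge_mem _ _ (f.next_spec _ t ht).2
    exact hsep' _ (Or.inl rfl) x hx t hx'
  set X := D.bag (D.node i) with hXdef
  set P := D.lowerRegion i (D.node i)
  set θ := D.newVertex i with hθdef
  have hθP : θ ∉ P := Set.disjoint_left.1 hXP hθX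
  have hunk : ∀ (f : Selector G Set.univ), ∀ s ∈ X, ∀ t ∈ P, f.next s = some t →
      localView X P f s ≠ View.unknown :=
    fun f s hs t ht h => localView_ne_unknown.2 ⟨hs, Or.inr ⟨t, ht, h⟩⟩
  ext ψ
  constructor
  · rintro ⟨_, ⟨f₀, hf₀, rfl⟩, S, T, ⟨hSX, hTX, hS, hSφ, hST, hB1, hB2, hB3, hB4⟩, rfl⟩
    obtain ⟨f, hag, rfl, rfl⟩ := exists_setEdges hXP hθX f₀ hSX hTX hS hST
      (fun s hs => edge_of_true_mem ((hb i hc).2 s (hSX hs)).1 (hB1 s hs))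
      (fun s hs => edge_of_true_mem ((hb i hc).2 s (hTX hs)).2 (hB3 s hs).1)
      (fun t ht h => hSφ (hunk f₀ _ hθX t ht h))
      (fun s hs t ht h => hunk f₀ s (hTX hs) t ht h (hB3 s hs).2)
    refine ⟨f, (D.admissible_insert hc).2 ⟨fun s hs => ⟨fun h => hB1 s ⟨hs, h⟩,
      fun h => hB2 s ⟨hs, fun h' => h h'.2⟩, fun h => (hB3 s ⟨hs, h⟩).1,
      fun h => hB4 s ⟨hs, fun h' => h h'.2⟩⟩,
      admissible_congr hf₀ hag fun s hs => hsep' s (Or.inr hs)⟩, ?_⟩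
    rw [← hresolve f, hag.localView_eq]
  · rintro ⟨f, hf, rfl⟩
    obtain ⟨hr, hf⟩ := (D.admissible_insert hc).1 hf
    refine ⟨_, ⟨f, hf, rfl⟩, _, _, ⟨fun s hs => hs.1, fun s hs => hs.1, ?_, ?_, ?_, ?_, ?_, ?_, ?_⟩,
      (hresolve f).symm⟩
    · rintro s ⟨-, hs⟩ t ⟨-, ht⟩
      rw [hs, Option.some_inj] at ht
      exact ht
    · intro h
      obtain ⟨t, ht, hst⟩ := (localView_ne_unknown.1 h).2.resolve_left hθP
      ext s
      simp only [Set.mem_ofPred_eq, Set.mem_empty_iff_false, iff_false]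
      rintro ⟨hs, h'⟩
      rw [hst, Option.some_inj] at h'
      exact Set.disjoint_left.1 hXP hs (h' ▸ ht)
    · constructor
      · exact fun h => h.symm.subset rfl
      · rintro ⟨h, h'⟩
        ext s
        simp only [Set.mem_ofPred_eq, Set.mem_singleton_iff]
        constructor
        · rintro ⟨-, hs⟩
          exact Option.some_inj.1 (hs.symm.trans h')
        · rintro rfl
          exact ⟨h, h'⟩
    · exact fun s hs => (hr s hs.1).1 hs.2
    · exact fun s hs => (hr s hs.1).2.1 fun h => hs.2 ⟨hs.1, h⟩
    · refine fun s hs => ⟨(hr s hs.1).2.2.1 hs.2, ?_⟩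
      by_contra h
      obtain ⟨t, ht, hst⟩ := (localView_ne_unknown.1 h).2.resolve_left
        (Set.disjoint_left.1 hXP hs.1)
      rw [hs.2, Option.some_inj] at hst
      exact hθP (hst ▸ ht)
    · exact fun s hs => (hr s hs.1).2.2.2 fun h => hs.2 ⟨hs.1, h⟩

theorem omegaStar_admissibleViews_of_not_critical (b : ℕ → (V → Set Bool) × (V → Set Bool)) {i : ℕ}
    (h1 : 1 ≤ i) (hi : i + 1 ≤ D.len) (hc : ¬ D.Critical i) :
    D.omegaStar i (D.admissibleViews b (i + 1)) = D.admissibleViews b i := by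
  funext w
  by_cases hw : w ∈ D.theta i
  · rw [D.omegaStar_admissibleViews b h1 hi w hw, admissibleViews, if_pos hw,
      D.region_eq_of_not_critical h1 (by omega) hc]
  · rw [omegaStar, if_pos hw, admissibleViews, if_neg hw]

/-- The regions at level ℓ are empty, so the vectors do not matter and every view is `?`. -/
theorem omegaLast_eq [Nontrivial V] (b : ℕ → (V → Set Bool) × (V → Set Bool)) :
    D.omegaLast = D.admissibleViews b D.len := by
  funext w
  rw [omegaLast, admissibleViews, region_len]
  split_ifs
  · ext φ
    constructor
    · rintro rfl
      exact ⟨emptySelector G _, fun i _ h => absurd h (Set.notMem_empty _), localView_empty _⟩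
    · rintro ⟨f, -, rfl⟩
      exact localView_empty _
  · rfl

theorem admissibleViews_one (b : ℕ → (V → Set Bool) × (V → Set Bool)) :
    D.admissibleViews b 1 D.root = localView {σ} Set.univ '' D.admissible b Set.univ := by
  rw [admissibleViews, theta_one, if_pos (Set.mem_singleton _), region_one, D.bag_root]

end Traversal

theorem isWalk_append {X L : Type*} {Edge : X → L → X → Prop} {x z : X}
    {as bs : List (X × L × X)} :
    IsWalk Edge x (as ++ bs) z ↔ ∃ y, IsWalk Edge x as y ∧ IsWalk Edge y bs z := by
  induction as generalizing x with
  | nil => simp [IsWalk]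
  | cons e as ih =>
    obtain ⟨a, l, b⟩ := e
    simp only [List.cons_append, IsWalk, ih]
    constructor
    · rintro ⟨h1, h2, y, h3, h4⟩
      exact ⟨y, ⟨h1, h2, h3⟩, h4⟩
    · rintro ⟨y, ⟨h1, h2, h3⟩, h4⟩
      exact ⟨h1, h2, y, h3, h4⟩

namespace Traversal

variable {V 𝒱 : Type*} {C : ℕ} {G : ParityGame V C} {σ : V} (D : Traversal G 𝒱 σ)
  {b b' : ℕ → (V → Set Bool) × (V → Set Bool)}

/-! ## The generic path given by a sequence of vectors -/

/-- A region at level `i` lies in Ψ_{> i-1}, so its vertices are introduced at indices at least `i`.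
-/
theorem admissibleViews_congr {i : ℕ} (h : ∀ j, D.Critical j → i ≤ j → b j = b' j) :
    D.admissibleViews b i = D.admissibleViews b' i := by
  have hadm : ∀ w, D.admissible b (D.region i w) = D.admissible b' (D.region i w) := by
    intro w
    ext f
    refine forall_congr' fun j => forall_congr' fun hj => forall_congr' fun hP => ?_
    rw [h j hj]
    by_contra hlt
    exact hj.newVertex_mem.2 (D.psiGT_antitone (by omega) hP.1)
  funext w
  rw [admissibleViews, admissibleViews, hadm]

/-- The nominal path from level `i + 1` to level `i` given by the vectors `b`. -/
def nominalSteps (b : ℕ → (V → Set Bool) × (V → Set Bool)) (i : ℕ) :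
    List (Vertex V 𝒱 × Label (Letter V 𝒱) × Vertex V 𝒱) :=
  if D.Critical i then
    [(.nominal (i + 1) (D.admissibleViews b (i + 1)),
        .opening (.state i (D.admissibleViews b (i + 1))), .zero i),
     (.zero i, .opening (.vectors i (b i).1 (b i).2), .one i),
     (.one i, .closing (.vectors i (b i).1 (b i).2), .vectors i (b i).1 (b i).2),
     (.vectors i (b i).1 (b i).2, .closing (.state i (D.admissibleViews b (i + 1))),
        .nominal i (D.admissibleViews b i))]
  else
    [(.nominal (i + 1) (D.admissibleViews b (i + 1)), .neutral,
      .nominal i (D.admissibleViews b i))]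

/-- The nominal paths from level `n + 1` to level `1` given by the vectors `b`. -/
def nominalBlocks (b : ℕ → (V → Set Bool) × (V → Set Bool)) :
    ℕ → List (List (Vertex V 𝒱 × Label (Letter V 𝒱) × Vertex V 𝒱))
  | 0 => []
  | n + 1 => D.nominalSteps b (n + 1) :: nominalBlocks b n

theorem isNominal_nominalSteps (i : ℕ) : IsNominal (D.nominalSteps b i) := by
  rw [nominalSteps]
  split_ifs
  · exact Or.inr ⟨_, _, _, _, _, rfl⟩
  · exact Or.inl ⟨_, _, _, rfl⟩

theorem isNominal_of_mem_nominalBlocks {n : ℕ} : ∀ es ∈ D.nominalBlocks b n, IsNominal es := by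
  induction n with
  | zero => simp [nominalBlocks]
  | succ n ih =>
    intro es hes
    rcases List.mem_cons.1 hes with rfl | h
    · exact D.isNominal_nominalSteps _
    · exact ih es h

theorem isDyck_nominalBlocks (n : ℕ) :
    IsDyck ((D.nominalBlocks b n).flatten.map fun e => e.2.1) := by
  induction n with
  | zero => exact .nil
  | succ n ih =>
    rw [nominalBlocks, List.flatten_cons, List.map_append, nominalSteps]
    split_ifs
    · exact .pair (.opening (.state _ _))
        [.opening (Letter.vectors _ _ _), .closing (Letter.vectors _ _ _)] _
        (by simp) (.pair (.opening (Letter.vectors _ _ _)) [] [] (by simp) .nil .nil) ih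
    · exact .neutral [] _ .nil ih

theorem nominalBlocks_congr (h : ∀ j, D.Critical j → b j = b' j) (n : ℕ) :
    D.nominalBlocks b n = D.nominalBlocks b' n := by
  have hv : ∀ i, D.admissibleViews b i = D.admissibleViews b' i :=
    fun i => D.admissibleViews_congr fun j hj _ => h j hj
  induction n with
  | zero => rfl
  | succ n ih =>
    rw [nominalBlocks, nominalBlocks, ih, nominalSteps, nominalSteps, hv, hv]
    split_ifs with hc
    · rw [h _ hc]
    · rfl

theorem visits_nominalBlocks {n i : ℕ} {B B' : V → Set Bool} :
    (∃ e ∈ (D.nominalBlocks b n).flatten, Vertex.vectors i B B' = e.2.2) ↔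
      D.Critical i ∧ i ≤ n ∧ b i = (B, B') := by
  induction n with
  | zero =>
    simp only [nominalBlocks, List.flatten_nil, List.not_mem_nil, false_and, exists_false,
      false_iff]
    rintro ⟨h, h', -⟩
    have := h.1
    omega
  | succ n ih =>
    have hsteps : (∃ e ∈ D.nominalSteps b (n + 1), Vertex.vectors i B B' = e.2.2) ↔
        D.Critical (n + 1) ∧ i = n + 1 ∧ b i = (B, B') := by
      rw [nominalSteps]
      split_ifs with hc
      · simp only [List.mem_cons, List.not_mem_nil, or_false, exists_eq_or_imp, exists_eq_left,
          Vertex.vectors.injEq, reduceCtorEq, false_or, hc, true_and]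
        constructor
        · rintro ⟨rfl, rfl, rfl⟩
          exact ⟨rfl, rfl⟩
        · rintro ⟨rfl, h⟩
          rw [h]
          exact ⟨rfl, rfl, rfl⟩
      · simp [hc]
    rw [nominalBlocks, List.flatten_cons]
    simp only [List.mem_append, or_and_right, exists_or, hsteps, ih]
    constructor
    · rintro (⟨h1, rfl, h2⟩ | ⟨h1, h2, h3⟩)
      · exact ⟨h1, le_rfl, h2⟩
      · exact ⟨h1, by omega, h3⟩
    · rintro ⟨h1, h2, h3⟩
      rcases Nat.lt_or_ge n i with h | h
      · obtain rfl : i = n + 1 := by omega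
        exact Or.inl ⟨h1, rfl, h3⟩
      · exact Or.inr ⟨h1, h, h3⟩

variable [Nontrivial V]

theorem isWalk_nominalBlocks (hb : D.ValidVectors b) {n : ℕ} (hn : n + 1 ≤ D.len) :
    IsWalk D.Edge (.nominal (n + 1) (D.admissibleViews b (n + 1))) (D.nominalBlocks b n).flatten
      (.nominal 1 (D.admissibleViews b 1)) := by
  induction n with
  | zero => rfl
  | succ n ih =>
    have hZ := D.admissibleViews_mem_lamIdx b (by omega : 1 ≤ n + 1 + 1) hn
    rw [nominalBlocks, List.flatten_cons, isWalk_append]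
    refine ⟨_, ?_, ih (by omega)⟩
    rw [nominalSteps]
    split_ifs with hc
    · refine ⟨rfl, .push _ _ hn hc hZ, rfl, .choose _ _ _ hn hc (hb _ hc).1 (hb _ hc).2, rfl,
        .check _ _ _ hn hc (hb _ hc).1, rfl, ?_, rfl⟩
      have := Edge.pop (D := D) (n + 1) _ _ _ hn hc hZ (hb _ hc).1
      rwa [D.omegaCrit_admissibleViews hb hc] at this
    · refine ⟨rfl, ?_, rfl⟩
      have := Edge.neutral (D := D) (n + 1) _ (by omega) hn hc hZ
      rwa [D.omegaStar_admissibleViews_of_not_critical b (by omega) hn hc] at this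

/-- The generic Dyck path given by the vectors `b`. -/
def genericPath (b : ℕ → (V → Set Bool) × (V → Set Bool)) (hb : D.ValidVectors b) :
    LabelledPath D.Edge where
  src := .nominal D.len D.omegaLast
  steps := (D.nominalBlocks b (D.len - 1)).flatten
  tgt := .nominal 1 (D.admissibleViews b 1)
  isWalk := by
    have h2 := D.two_le_len
    have := D.isWalk_nominalBlocks hb (n := D.len - 1) (by omega)
    rwa [Nat.sub_add_cancel (by omega), ← D.omegaLast_eq b] at this

theorem isGeneric_genericPath (hb : D.ValidVectors b) : D.IsGeneric (D.genericPath b hb) :=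
  ⟨D.isDyck_nominalBlocks _, _, D.isNominal_of_mem_nominalBlocks, rfl⟩

theorem genericPath_congr (hb : D.ValidVectors b) (hb' : D.ValidVectors b')
    (h : ∀ j, D.Critical j → b j = b' j) : D.genericPath b hb = D.genericPath b' hb' := by
  simp only [genericPath, D.nominalBlocks_congr h,
    D.admissibleViews_congr (i := 1) fun j hj _ => h j hj]

theorem visits_genericPath (hb : D.ValidVectors b) {i : ℕ} {B B' : V → Set Bool} :
    (D.genericPath b hb).Visits (.vectors i B B') ↔ D.Critical i ∧ b i = (B, B') := by
  rw [LabelledPath.Visits]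
  change (Vertex.vectors i B B' = .nominal _ _ ∨
    ∃ e ∈ (D.nominalBlocks b (D.len - 1)).flatten, Vertex.vectors i B B' = e.2.2) ↔ _
  rw [visits_nominalBlocks]
  constructor
  · rintro (h | ⟨h1, -, h2⟩)
    · cases h
    · exact ⟨h1, h2⟩
  · rintro ⟨h1, h2⟩
    have := h1.lt_len
    exact Or.inr ⟨h1, by omega, h2⟩

/-- Every concatenation of nominal paths is given by a sequence of vectors. -/
theorem exists_vectors_of_isWalk {n : ℕ} (hn : n + 1 ≤ D.len) (hb : D.ValidVectors b)
    {bs : List (List (Vertex V 𝒱 × Label (Letter V 𝒱) × Vertex V 𝒱))}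
    (hbs : ∀ es ∈ bs, IsNominal es) {Z' : 𝒱 → Set (LocalView V)}
    (h : IsWalk D.Edge (.nominal (n + 1) (D.admissibleViews b (n + 1))) bs.flatten
      (.nominal 1 Z')) :
    ∃ b', D.ValidVectors b' ∧ bs.flatten = (D.nominalBlocks b' n).flatten ∧
      Z' = D.admissibleViews b' 1 ∧ ∀ i, n < i → b' i = b i := by
  -- The views at level `n + 1` depend only on the vectors above `n`. The vectors below are filled
  -- in as blocks are read, hence the generalization over `b`.
  induction n generalizing b bs with
  | zero =>
    cases bs with
    | nil =>
      refine ⟨b, hb, rfl, ?_, fun _ _ => rfl⟩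
      have : Vertex.nominal 1 (D.admissibleViews b 1) = .nominal 1 Z' := h
      exact (Vertex.nominal.injEq .. ▸ this).2.symm
    | cons es bs =>
      -- Each block goes down one level, and no edge goes from level 1 to level 0.
      exfalso
      rw [List.flatten_cons, isWalk_append] at h
      obtain ⟨y, h, -⟩ := h
      rcases hbs es List.mem_cons_self with ⟨i, Z, Z₁, rfl⟩ | ⟨i, Z, B, B', Z₁, rfl⟩
      · obtain ⟨h0, h1, -⟩ := h
        cases h0
        cases h1
        omega
      · obtain ⟨h0, h1, -⟩ := h
        cases h0
        cases h1 with
        | push _ _ _ hc _ =>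
          have := hc.1
          omega
  | succ n ih =>
    cases bs with
    | nil =>
      have : Vertex.nominal (n + 1 + 1) (D.admissibleViews b (n + 1 + 1)) = .nominal 1 Z' := h
      rw [Vertex.nominal.injEq] at this
      omega
    | cons es bs =>
      rw [List.flatten_cons, isWalk_append] at h
      obtain ⟨y, h, htail⟩ := h
      have hbs' : ∀ es ∈ bs, IsNominal es := fun es h => hbs es (List.mem_cons_of_mem _ h)
      suffices H : ∃ b₁, D.ValidVectors b₁ ∧ es = D.nominalSteps b₁ (n + 1) ∧
          y = .nominal (n + 1) (D.admissibleViews b₁ (n + 1)) ∧ ∀ i, n + 1 < i → b₁ i = b i by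
        obtain ⟨b₁, hb₁, rfl, rfl, h₁⟩ := H
        obtain ⟨b₂, hb₂, h2, h3, h4⟩ := ih (by omega) hb₁ hbs' htail
        have hv : ∀ i, n < i → D.admissibleViews b₂ i = D.admissibleViews b₁ i :=
          fun i hi => D.admissibleViews_congr fun j _ hj => h4 j (by omega)
        refine ⟨b₂, hb₂, ?_, h3, fun i hi => (h4 i (by omega)).trans (h₁ i hi)⟩
        rw [nominalBlocks, List.flatten_cons, List.flatten_cons, h2, nominalSteps, nominalSteps,
          hv _ (by omega), hv _ (by omega), h4 _ (by omega)]
      rcases hbs es List.mem_cons_self with ⟨i, Z, Z₁, rfl⟩ | ⟨i, Z, B, B', Z₁, rfl⟩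
      · obtain ⟨h0, h1, h2⟩ := h
        cases h0
        cases h1 with
        | neutral _ _ hi1 hi hc hZ =>
          have hstar := D.omegaStar_admissibleViews_of_not_critical b (by omega) hn hc
          refine ⟨b, hb, ?_, ?_, fun _ _ => rfl⟩
          · rw [nominalSteps, if_neg hc, hstar]
          · rw [← hstar]
            exact Eq.symm h2
      · obtain ⟨h0, h1, -, h2, -, h3, -, h4, h5⟩ := h
        cases h0
        cases h1 with
        | push _ _ hi hc hZ =>
        cases h2 with
        | choose _ _ _ _ _ hs hch =>
        cases h4 with
        | pop _ _ _ _ _ _ _ _ =>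
          -- Overwrite the vectors at `n + 1` by those read in the block. The views at higher levels
          -- do not see this index.
          have hup : ∀ i, n + 1 < i → Function.update b (n + 1) (B, B') i = b i :=
            fun i hi => Function.update_of_ne (by omega) _ _
          have hself : Function.update b (n + 1) (B, B') (n + 1) = (B, B') :=
            Function.update_self _ _ _
          have hval : D.ValidVectors (Function.update b (n + 1) (B, B')) := by
            intro i hi
            by_cases h : i = n + 1
            · subst h
              rw [hself]
              exact ⟨hs, hch⟩
            · rw [Function.update_of_ne h]
              exact hb i hi
          have hv : D.admissibleViews (Function.update b (n + 1) (B, B')) (n + 1 + 1) =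
              D.admissibleViews b (n + 1 + 1) :=
            D.admissibleViews_congr fun j _ hj => hup j (by omega)
          have hcrit := D.omegaCrit_admissibleViews hval hc
          rw [hself, hv] at hcrit
          refine ⟨_, hval, ?_, ?_, hup⟩
          · rw [nominalSteps, if_pos hc, hself, hv, hcrit]
          · rw [← hcrit]
            exact Eq.symm h5

/-- The given `b` only starts the induction, since vectors are irrelevant at level ℓ. At level 1 the
region is all of V, so a view in the sink comes from a selector that is admissible everywhere. -/
theorem exists_eq_genericPath (hb : D.ValidVectors b) {π : LabelledPath D.Edge}
    (hπ : π ∈ D.DyckClass) :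
    ∃ b', ∃ hb' : D.ValidVectors b', π = D.genericPath b' hb' ∧
      (D.admissible b' Set.univ).Nonempty := by
  obtain ⟨⟨-, bs, hbs, hsteps⟩, hsrc, Z, -, htgt, hne⟩ := hπ
  obtain ⟨src, steps, tgt, hwalk⟩ := π
  dsimp only at hsteps hsrc htgt
  subst hsteps hsrc htgt
  have h2 := D.two_le_len
  have hlen : D.len - 1 + 1 = D.len := by omega
  have hw := hwalk
  rw [D.omegaLast_eq b, ← hlen] at hw
  obtain ⟨b', hb', hs, rfl, -⟩ := D.exists_vectors_of_isWalk (by omega) hb hbs hw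
  refine ⟨b', hb', ?_, ?_⟩
  · simp only [genericPath, hs]
  · rw [admissibleViews_one] at hne
    exact hne.of_image

end Traversal

section OnePlayer

variable {V : Type*} {C : ℕ} {G : ParityGame V C} {g : Selector G G.V0} {σ : V}
  {p : ℕ → Option V}

/-! ## Winning selectors and their extensions -/

/-- A `V`-selector that leaves each vertex `x` of an outcome `p` as `p` does at time `τ x`. -/
theorem exists_follow (hp : IsOutcome g σ p) (τ : V → ℕ)
    (hτ : ∀ x, (∃ n, p n = some x) → p (τ x) = some x) :
    ∃ f, Extends f g ∧ ∀ x, (∃ n, p n = some x) → f.next x = p (τ x + 1) := by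
  refine ⟨⟨fun x => if ∃ n, p n = some x then p (τ x + 1) else if x ∈ G.V0 then g.next x else none,
    fun s t h => ⟨trivial, ?_⟩⟩, fun s hs => ?_, fun x hx => if_pos hx⟩
  · split_ifs at h with h1 h2
    · obtain ⟨-, h3⟩ := hp.2 (τ s)
      have h4 := h3 s (hτ s h1)
      by_cases hs : s ∈ G.V0
      · rw [h4.1 hs] at h
        exact (g.next_spec s t h).2
      · rcases h4.2 hs with ⟨y, hy, hy'⟩ | ⟨-, hy⟩
        · rw [hy', Option.some_inj] at h
          exact h ▸ hy
        · rw [hy] at h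
          cases h
    · exact (g.next_spec s t h).2
  · dsimp only
    split_ifs with h1
    · exact ((hp.2 (τ s)).2 s (hτ s h1)).1 hs
    · rfl

theorem not_wonByP0_of_next {f : Selector G Set.univ} {x y : V} (h : f.next x = some y)
    (hy : ¬ WonByP0 G (outcome f y)) : ¬ WonByP0 G (outcome f x) := by
  rwa [wonByP0_shift (n := 1) (show outcome f x 1 = some y from h)]

/-- Leave each vertex as `p` does at its last visit. Along the outcome the times of last visit
increase strictly, so it reaches the end of `p`, where P_0 loses. -/
theorem exists_losing_of_finite (hp : IsOutcome g σ p) {N : ℕ} {s : V} (hN : p N = some s)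
    (hN1 : p (N + 1) = none) (hs : s ∈ G.V0) : ∃ f, Extends f g ∧ ¬ WonByP0 G (outcome f σ) := by
  have hnone : ∀ n, N < n → p n = none := by
    intro n hn
    induction n, (hn : N + 1 ≤ n) using Nat.le_induction with
    | base => exact hN1
    | succ n _ ih => exact (hp.2 n).1 ih
  have hle : ∀ {n x}, p n = some x → n ≤ N := by
    intro n x h
    by_contra hc
    rw [hnone n (by omega)] at h
    cases h
  set τ : V → ℕ := fun x => Nat.findGreatest (fun n => p n = some x) N with hτdef
  have hτ : ∀ x, (∃ n, p n = some x) → p (τ x) = some x := fun x ⟨n, hn⟩ =>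
    Nat.findGreatest_spec (P := fun n => p n = some x) (hle hn) hn
  obtain ⟨f, hf, hnext⟩ := exists_follow hp τ hτ
  refine ⟨f, hf, ?_⟩
  suffices H : ∀ d x, (∃ n, p n = some x) → N - τ x = d → ¬ WonByP0 G (outcome f x) from
    H _ σ ⟨0, hp.1⟩ rfl
  intro d
  induction d using Nat.strong_induction_on with
  | _ d ih =>
    rintro x hx rfl
    have hx' := hnext x hx
    rcases (hle (hτ x hx)).lt_or_eq with hlt | heq
    · have hsome : ∃ y, p (τ x + 1) = some y := by
        by_contra hc
        have h0 : p (τ x + 1) = none := by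
          cases h : p (τ x + 1) with
          | none => rfl
          | some y => exact absurd ⟨y, h⟩ hc
        have : ∀ n, τ x + 1 ≤ n → p n = none := by
          intro n hn
          induction n, hn using Nat.le_induction with
          | base => exact h0
          | succ n h ih => exact (hp.2 n).1 ih
        rw [this N hlt] at hN
        cases hN
      obtain ⟨y, hy⟩ := hsome
      have hge : τ x + 1 ≤ τ y := Nat.le_findGreatest hlt hy
      exact not_wonByP0_of_next (hx'.trans hy) (ih _ (by omega) y ⟨_, hy⟩ rfl)
    · rw [heq, hN1] at hx'
      have hxs := hτ x hx
      rw [heq, hN, Option.some_inj] at hxs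
      rw [wonByP0_of_next_eq_none hx', ← hxs]
      exact not_not.2 hs

/-- Let `R` be the set of vertices that `p` visits infinitely often, and `t ∈ R` of largest colour,
which is odd since P_0 loses. Outside of `R`, leave each vertex as at its last visit, which
eventually leads into `R`; inside, follow a stretch of `p` that reaches `t` soonest. The outcome
ends up in `R` and visits `t` again and again. -/
theorem exists_losing_of_infinite [Finite V] (hp : IsOutcome g σ p) (hinf : ∀ n, ∃ s, p n = some s)
    (hlost : ¬ WonByP0 G p) : ∃ f, Extends f g ∧ ¬ WonByP0 G (outcome f σ) := by
  choose q hq using hinf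
  -- There are finitely many vertices, so from some time `N` on only recurrent ones are visited.
  obtain ⟨N, hN⟩ : ∃ N, ∀ n ≥ N, ∃ᶠ m in atTop, q m = q n := by
    have : ∀ x : V, ∀ᶠ n in atTop, (¬ ∃ᶠ m in atTop, q m = x) → q n ≠ x := by
      intro x
      by_cases h : ∃ᶠ m in atTop, q m = x
      · exact Eventually.of_forall fun n hn => absurd h hn
      · exact (not_frequently.1 h).mono fun n hn _ => hn
    obtain ⟨N, hN⟩ := eventually_atTop.1 (eventually_all.2 this)
    exact ⟨N, fun n hn => by_contra fun h => hN n hn (q n) h rfl⟩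
  set R : Set V := {x | ∃ᶠ m in atTop, q m = x} with hR
  obtain ⟨t, ht, hmax⟩ := Set.exists_max_image R G.color (Set.toFinite R) ⟨q N, hN N le_rfl⟩
  have hodd : ¬ Even (G.color t) := by
    intro hev
    refine hlost (Or.inr ⟨fun n => ⟨_, hq n⟩, _, hev, ?_, ?_⟩)
    · exact ht.mono fun n hn => ⟨t, hn ▸ hq n, rfl⟩
    · refine eventually_atTop.2 ⟨N, fun n hn s hs => ?_⟩
      rw [hq, Option.some_inj] at hs
      exact hs ▸ hmax _ (hN n hn)
  have hex : ∀ x ∈ R, ∃ d n, N ≤ n ∧ q n = x ∧ q (n + d) = t := by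
    intro x hx
    obtain ⟨n, hn, hnx⟩ := frequently_atTop.1 hx N
    obtain ⟨m, hm, hmt⟩ := frequently_atTop.1 ht n
    exact ⟨m - n, n, hn, hnx, by rwa [Nat.add_sub_cancel' hm]⟩
  -- `r x` is the least number of steps that `p` takes to `t` from a visit of `x` at a time at least
  -- `N`.
  set r : V → ℕ := fun x => if h : x ∈ R then Nat.find (hex x h) else 0 with hr
  have hrspec : ∀ x ∈ R, ∃ n, N ≤ n ∧ q n = x ∧ q (n + r x) = t := by
    intro x hx
    simp only [hr, dif_pos hx]
    exact Nat.find_spec (hex x hx)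
  have hrmin : ∀ n d, N ≤ n → q (n + d) = t → r (q n) ≤ d := by
    intro n d hn hd
    have hx : q n ∈ R := hN n hn
    simp only [hr, dif_pos hx]
    exact Nat.find_min' _ ⟨n, hn, rfl, hd⟩
  choose! u hu1 hu2 hu3 using hrspec
  set τ : V → ℕ := fun x => if x ∈ R then u x else Nat.findGreatest (fun n => q n = x) N with hτdef
  have hτR : ∀ x ∈ R, τ x = u x := fun x hx => if_pos hx
  have hτN : ∀ x ∉ R, τ x = Nat.findGreatest (fun n => q n = x) N := fun x hx => if_neg hx
  have hlt : ∀ n, q n ∉ R → n < N := fun n hn => by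
    by_contra hc
    exact hn (hN n (by omega))
  have hτ' : ∀ x, (∃ n, q n = x) → q (τ x) = x := by
    rintro _ ⟨n, rfl⟩
    by_cases hx : q n ∈ R
    · rw [hτR _ hx, hu2 _ hx]
    · rw [hτN _ hx]
      exact Nat.findGreatest_spec (P := fun m => q m = q n) (hlt n hx).le rfl
  have hvis : ∀ x, (∃ n, p n = some x) ↔ ∃ n, q n = x := fun x =>
    exists_congr fun n => by rw [hq, Option.some_inj]
  obtain ⟨f, hf, hnext⟩ := exists_follow hp τ fun x hx => by
    rw [hq, hτ' x ((hvis x).1 hx)]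
  replace hnext : ∀ x, (∃ n, q n = x) → f.next x = some (q (τ x + 1)) := fun x hx => by
    rw [hnext x ((hvis x).2 hx), hq]
  have hRvis : ∀ x ∈ R, ∃ n, q n = x := fun x hx => ⟨u x, hu2 x hx⟩
  have hstep : ∀ x ∈ R, q (τ x + 1) ∈ R := fun x hx =>
    hN _ (by rw [hτR x hx]; exact (hu1 x hx).trans (Nat.le_succ _))
  have hstay : ∀ x ∈ R, ∀ k, ∃ y ∈ R, outcome f x k = some y := by
    intro x hx k
    induction k with
    | zero => exact ⟨x, hx, rfl⟩
    | succ k ih =>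
      obtain ⟨y, hy, hy'⟩ := ih
      exact ⟨_, hstep y hy, by rw [outcome, hy']; exact hnext y (hRvis y hy)⟩
  have hreach : ∀ d, ∀ x ∈ R, r x = d → ∃ k, outcome f x k = some t := by
    intro d
    induction d using Nat.strong_induction_on with
    | _ d ih =>
      rintro x hx rfl
      rcases Nat.eq_zero_or_pos (r x) with h | h
      · have := hu3 x hx
        rw [h, Nat.add_zero, hu2 x hx] at this
        exact ⟨0, by rw [this]; rfl⟩
      · have hry : r (q (τ x + 1)) ≤ r x - 1 := by
          refine hrmin _ _ (by rw [hτR x hx]; exact (hu1 x hx).trans (Nat.le_succ _)) ?_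
          rw [hτR x hx, ← hu3 x hx]
          congr 1
          omega
        obtain ⟨k, hk⟩ := ih _ (by omega) _ (hstep x hx) rfl
        exact ⟨1 + k, by
          rw [outcome_add (show outcome f x 1 = _ from hnext x (hRvis x hx)), hk]⟩
  have hlostR : ∀ x ∈ R, ¬ WonByP0 G (outcome f x) := by
    rintro x hx (⟨k, s, -, h, -⟩ | ⟨-, m, hm, hfr, hev⟩)
    · obtain ⟨y, -, hy⟩ := hstay x hx (k + 1)
      rw [hy] at h
      cases h
    · obtain ⟨k, s, hk, hs⟩ := hfr.exists
      obtain ⟨y, hy, hy'⟩ := hstay x hx k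
      rw [hk, Option.some_inj] at hy'
      have h1 : m ≤ G.color t := hs ▸ hy' ▸ hmax y hy
      obtain ⟨K, hK⟩ := eventually_atTop.1 hev
      obtain ⟨z, hz, hz'⟩ := hstay x hx K
      obtain ⟨j, hj⟩ := hreach _ z hz rfl
      have h2 := hK (K + j) (by omega) t (by rw [outcome_add hz', hj])
      exact hodd ((by omega : m = G.color t) ▸ hm)
  refine ⟨f, hf, ?_⟩
  -- Until `R` is reached, the times of last visit increase and stay below `N`.
  suffices H : ∀ d x, (∃ n, q n = x) → N - τ x = d → ¬ WonByP0 G (outcome f x) by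
    refine H _ σ ⟨0, ?_⟩ rfl
    have := hp.1
    rwa [hq, Option.some_inj] at this
  intro d
  induction d using Nat.strong_induction_on with
  | _ d ih =>
    rintro x hx rfl
    by_cases hxR : x ∈ R
    · exact hlostR x hxR
    refine not_wonByP0_of_next (hnext x hx) ?_
    by_cases hyR : q (τ x + 1) ∈ R
    · exact hlostR _ hyR
    have hx' := hτ' x hx
    have h1 := hlt _ (hx'.symm ▸ hxR : q (τ x) ∉ R)
    have h2 : τ x + 1 ≤ τ (q (τ x + 1)) := by
      rw [hτN _ hyR]
      exact Nat.le_findGreatest h1 rfl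
    exact ih _ (by omega) _ ⟨_, rfl⟩ rfl

/-- Once `g` is fixed, P_1 plays alone, and a single player needs no memory: a lost outcome can be
turned into a lost positional one. -/
theorem winsFrom_iff [Finite V] :
    WinsFrom g σ ↔ ∀ f, Extends f g → WonByP0 G (outcome f σ) := by
  constructor
  · intro h f hf
    -- An extension may stop at a vertex of P_1 that has successors, which an outcome of `g` may
    -- not. P_0 wins in that case by definition.
    by_cases hlast : ∃ n s, outcome f σ n = some s ∧ outcome f σ (n + 1) = none ∧ s ∉ G.V0
    · exact Or.inl hlast
    refine h _ ⟨rfl, fun n => ⟨fun hn => outcome_none_mono hn (Nat.le_succ n), fun x hx => ?_⟩⟩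
    have hsucc : outcome f σ (n + 1) = f.next x := by rw [outcome, hx]; rfl
    refine ⟨fun hx0 => hsucc.trans (hf x hx0), fun hx0 => ?_⟩
    cases hy : f.next x with
    | none => exact absurd ⟨n, x, hx, hsucc.trans hy, hx0⟩ hlast
    | some y => exact Or.inl ⟨y, (f.next_spec x y hy).2, hsucc.trans hy⟩
  · intro h p hp
    by_contra hlost
    suffices H : ∃ f, Extends f g ∧ ¬ WonByP0 G (outcome f σ) by
      obtain ⟨f, hf, hf'⟩ := H
      exact hf' (h f hf)
    by_cases hinf : ∀ n, ∃ s, p n = some s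
    · exact exists_losing_of_infinite hp hinf hlost
    · have hex : ∃ n, p n = none := by
        by_contra hc
        refine hinf fun n => ?_
        cases hn : p n with
        | none => exact absurd ⟨n, hn⟩ hc
        | some s => exact ⟨s, rfl⟩
      have hspec := Nat.find_spec hex
      have hmin := fun m => @Nat.find_min _ _ hex m
      cases hk : Nat.find hex with
      | zero =>
        rw [hk, hp.1] at hspec
        cases hspec
      | succ k =>
        rw [hk] at hspec
        cases hs : p k with
        | none => exact absurd hs (hmin k (by omega))
        | some s =>
          refine exists_losing_of_finite hp hs hspec ?_
          by_contra hs0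
          exact hlost (Or.inl ⟨k, s, hs, hspec, hs0⟩)

end OnePlayer

namespace Traversal

variable {V 𝒱 : Type*} {C : ℕ} {G : ParityGame V C} {σ : V} (D : Traversal G 𝒱 σ)
  {b : ℕ → (V → Set Bool) × (V → Set Bool)}

/-! ## The vectors of a selector -/

/-- The entry of `choice(x, y)` that corresponds to a `V_0`-selector. -/
def selectorChoice (g : Selector G G.V0) (x y : V) : Set Bool :=
  if ¬ G.E x y then {false}
  else if x ∈ G.V0 then {decide (g.next x = some y)}
  else {false, true}

theorem selectorChoice_of_not_edge {g : Selector G G.V0} {x y : V} (h : ¬ G.E x y) :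
    selectorChoice g x y = {false} := if_pos h

theorem selectorChoice_of_mem {g : Selector G G.V0} {x y : V} (h : G.E x y) (hx : x ∈ G.V0) :
    selectorChoice g x y = {decide (g.next x = some y)} := by
  rw [selectorChoice, if_neg (not_not.2 h), if_pos hx]

theorem selectorChoice_of_notMem {g : Selector G G.V0} {x y : V} (h : G.E x y) (hx : x ∉ G.V0) :
    selectorChoice g x y = {false, true} := by
  rw [selectorChoice, if_neg (not_not.2 h), if_neg hx]

theorem selectorChoice_mem (g : Selector G G.V0) (x y : V) :
    selectorChoice g x y ∈ choice G x y := by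
  by_cases hE : G.E x y
  · by_cases hx : x ∈ G.V0
    · rw [selectorChoice_of_mem hE hx, choice, if_neg (not_not.2 hE), if_pos hx]
      by_cases h : g.next x = some y <;> simp [h]
    · rw [selectorChoice_of_notMem hE hx, choice, if_neg (not_not.2 hE), if_neg hx]
      rfl
  · rw [selectorChoice_of_not_edge hE, choice, if_pos hE]
    rfl

theorem true_mem_selectorChoice {g : Selector G G.V0} {x y : V} :
    true ∈ selectorChoice g x y ↔ G.E x y ∧ (x ∈ G.V0 → g.next x = some y) := by
  by_cases hE : G.E x y
  · by_cases hx : x ∈ G.V0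
    · simp [selectorChoice_of_mem hE hx, hE, hx]
    · simp [selectorChoice_of_notMem hE hx, hE, hx]
  · simp [selectorChoice_of_not_edge hE, hE]

theorem false_mem_selectorChoice {g : Selector G G.V0} {x y : V} :
    false ∈ selectorChoice g x y ↔ (x ∈ G.V0 → g.next x ≠ some y) := by
  by_cases hE : G.E x y
  · by_cases hx : x ∈ G.V0
    · simp [selectorChoice_of_mem hE hx, hx]
    · simp [selectorChoice_of_notMem hE hx, hx]
  · rw [selectorChoice_of_not_edge hE]
    exact ⟨fun _ _ h => hE (g.next_spec x y h).2, fun _ => rfl⟩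

theorem selectorChoice_nonempty (g : Selector G G.V0) (x y : V) :
    (selectorChoice g x y).Nonempty := by
  by_cases h : g.next x = some y
  · exact ⟨true, true_mem_selectorChoice.2 ⟨(g.next_spec x y h).2, fun _ => h⟩⟩
  · exact ⟨false, false_mem_selectorChoice.2 fun _ => h⟩

theorem selectorChoice_eq_true {g : Selector G G.V0} {x y : V} (hx : x ∈ G.V0) :
    selectorChoice g x y = {true} ↔ g.next x = some y := by
  constructor
  · intro h
    exact (true_mem_selectorChoice.1 (h.symm ▸ Set.mem_singleton true)).2 hx
  · intro h
    simp [selectorChoice_of_mem (g.next_spec x y h).2 hx, h]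

/-- For an edge from a vertex of P_0, `choice` offers two singletons and the step of `f` decides
between them. In the other cases `choice` leaves no freedom. -/
theorem eq_selectorChoice {g : Selector G G.V0} {f : Selector G Set.univ} (hf : Extends f g)
    {x y : V} {B : Set Bool} (hB : B ∈ choice G x y) (ht : f.next x = some y → true ∈ B)
    (hn : f.next x ≠ some y → false ∈ B) : B = selectorChoice g x y := by
  rw [choice] at hB
  rw [selectorChoice]
  by_cases hE : G.E x y
  swap
  · rw [if_pos hE] at hB ⊢
    exact hB
  rw [if_neg (not_not.2 hE)] at hB ⊢
  by_cases hx : x ∈ G.V0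
  swap
  · rw [if_neg hx] at hB ⊢
    exact hB
  rw [if_pos hx] at hB ⊢
  rw [← hf x hx]
  rcases hB with rfl | hB
  · have : f.next x ≠ some y := fun h => by
      have := ht h
      simp at this
    simp [this]
  · rw [Set.mem_singleton_iff] at hB
    subst hB
    have : f.next x = some y := by
      by_contra h
      have := hn h
      simp at this
    simp [this]

/-- The vectors given by a `V_0`-selector. -/
def selectorVectors (g : Selector G G.V0) (i : ℕ) : (V → Set Bool) × (V → Set Bool) :=
  (fun s => if s ∈ D.bag (D.node i) then selectorChoice g (D.newVertex i) s else ∅,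
    fun s => if s ∈ D.bag (D.node i) then selectorChoice g s (D.newVertex i) else ∅)

theorem selectorVectors_fst (g : Selector G G.V0) {i : ℕ} {s : V} (hs : s ∈ D.bag (D.node i)) :
    (D.selectorVectors g i).1 s = selectorChoice g (D.newVertex i) s := if_pos hs

theorem selectorVectors_snd (g : Selector G G.V0) {i : ℕ} {s : V} (hs : s ∈ D.bag (D.node i)) :
    (D.selectorVectors g i).2 s = selectorChoice g s (D.newVertex i) := if_pos hs

theorem validVectors_selectorVectors (g : Selector G G.V0) :
    D.ValidVectors (D.selectorVectors g) := by
  refine fun i _ => ⟨fun s => ⟨fun hs => ?_, fun hs => ⟨if_neg hs, if_neg hs⟩⟩, fun s hs => ?_⟩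
  · rw [D.selectorVectors_fst g hs, D.selectorVectors_snd g hs]
    exact ⟨selectorChoice_nonempty _ _ _, selectorChoice_nonempty _ _ _⟩
  · rw [D.selectorVectors_fst g hs, D.selectorVectors_snd g hs]
    exact ⟨selectorChoice_mem _ _ _, selectorChoice_mem _ _ _⟩

/-- Each edge is considered at the critical index of one of its vertices. -/
theorem exists_critical_of_edge {s t : V} (h : G.E s t) :
    (∃ i, D.Critical i ∧ D.newVertex i = s ∧ t ∈ D.bag (D.node i)) ∨
    (∃ i, D.Critical i ∧ D.newVertex i = t ∧ s ∈ D.bag (D.node i)) := by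
  obtain ⟨x, hx, hx'⟩ := D.edge_mem s t h
  rcases D.mem_bag_topNode_or hx hx' with h | h
  · obtain ⟨i, hi, rfl⟩ := D.exists_critical s
    exact Or.inl ⟨i, hi, rfl, hi.topNode_eq ▸ h⟩
  · obtain ⟨i, hi, rfl⟩ := D.exists_critical t
    exact Or.inr ⟨i, hi, rfl, hi.topNode_eq ▸ h⟩

/-- Every edge is examined at the critical index of one of its ends. For an edge from V_0 the
vectors of `g` fix whether it is used; for an edge from a vertex of P_1 they impose nothing. -/
theorem admissible_selectorVectors (g : Selector G G.V0) :
    D.admissible (D.selectorVectors g) Set.univ = {f | Extends f g} := by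
  ext f
  constructor
  · intro h s hs
    have key : ∀ t, G.E s t → (f.next s = some t ↔ g.next s = some t) := by
      intro t ht
      rcases D.exists_critical_of_edge ht with ⟨i, hi, rfl, hm⟩ | ⟨i, hi, rfl, hm⟩
      · obtain ⟨h1, h2, -, -⟩ := h i hi trivial t hm
        rw [D.selectorVectors_fst g hm] at h1 h2
        exact ⟨fun h => (true_mem_selectorChoice.1 (h1 h)).2 hs, fun h => by_contra fun h' =>
          false_mem_selectorChoice.1 (h2 h') hs h⟩
      · obtain ⟨-, -, h1, h2⟩ := h i hi trivial s hm
        rw [D.selectorVectors_snd g hm] at h1 h2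
        exact ⟨fun h => (true_mem_selectorChoice.1 (h1 h)).2 hs, fun h => by_contra fun h' =>
          false_mem_selectorChoice.1 (h2 h') hs h⟩
    refine Option.ext fun t => ⟨fun h => ?_, fun h => ?_⟩
    · exact (key t (f.next_spec s t h).2).1 h
    · exact (key t (g.next_spec s t h).2).2 h
  · intro h i _ _ s hs
    have key : ∀ x y, (f.next x = some y → true ∈ selectorChoice g x y) ∧
        (f.next x ≠ some y → false ∈ selectorChoice g x y) := fun x y =>
      ⟨fun h' => true_mem_selectorChoice.2 ⟨(f.next_spec x y h').2, fun hx => h x hx ▸ h'⟩,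
        fun h' => false_mem_selectorChoice.2 fun hx => h x hx ▸ h'⟩
    rw [D.selectorVectors_fst g hs, D.selectorVectors_snd g hs]
    exact ⟨(key _ _).1, (key _ _).2, (key _ _).1, (key _ _).2⟩

/-- The restriction of a `V`-selector to `V_0`. -/
def restrict (f : Selector G Set.univ) : Selector G G.V0 where
  next s := if s ∈ G.V0 then f.next s else none
  next_spec s t h := by
    split_ifs at h with hs
    exact ⟨hs, (f.next_spec s t h).2⟩

theorem extends_restrict (f : Selector G Set.univ) : Extends f (restrict f) :=
  fun _ hs => (if_pos hs).symm

theorem exists_extends (g : Selector G G.V0) : ∃ f, Extends f g :=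
  ⟨⟨g.next, fun s t h => ⟨trivial, (g.next_spec s t h).2⟩⟩, fun _ _ => rfl⟩

theorem eq_selectorVectors (hb : D.ValidVectors b) {f : Selector G Set.univ}
    (hf : f ∈ D.admissible b Set.univ) {i : ℕ} (hi : D.Critical i) :
    b i = D.selectorVectors (restrict f) i := by
  have hr := hf i hi trivial
  obtain ⟨hs, hch⟩ := hb i hi
  refine Prod.ext (funext fun s => ?_) (funext fun s => ?_)
  · by_cases h : s ∈ D.bag (D.node i)
    · rw [D.selectorVectors_fst _ h]
      exact eq_selectorChoice (extends_restrict f) (hch s h).1 (hr s h).1 (hr s h).2.1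
    · rw [((hs s).2 h).1]
      exact (if_neg h).symm
  · by_cases h : s ∈ D.bag (D.node i)
    · rw [D.selectorVectors_snd _ h]
      exact eq_selectorChoice (extends_restrict f) (hch s h).2 (hr s h).2.2.1 (hr s h).2.2.2
    · rw [((hs s).2 h).2]
      exact (if_neg h).symm

/-- As E(π^g) is the graph of `g`, this gives both the injectivity of g ↦ π^g and the uniqueness of
the path with these edges. -/
theorem graph_injective {W : Set V} : Function.Injective (Selector.graph : Selector G W → _) := by
  rintro ⟨f, hf⟩ ⟨f', hf'⟩ h
  congr
  funext s
  exact Option.ext fun t => Set.ext_iff.1 h (s, t)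

theorem selView_one (f : Selector G Set.univ) :
    D.selView f 1 (D.node 1) = localView {σ} Set.univ f := by
  funext s
  rw [selView, node_one, D.bag_root, region_one, viewIn_univ, localView, regionView_univ]

theorem localView_eq_topAt {f : Selector G Set.univ} :
    localView {σ} Set.univ f = topAt σ ↔ WonByP0 G (outcome f σ) := by
  have hσ : localView {σ} Set.univ f σ = resultView f σ := by
    rw [localView_of_mem (Set.mem_singleton σ), regionView_univ]
  constructor
  · intro h
    by_contra hlost
    rw [h, topAt, if_pos rfl, resultView, if_neg hlost] at hσ
    cases hσ
  · intro h
    funext s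
    by_cases hs : s = σ
    · subst hs
      rw [hσ, resultView, if_pos h, topAt, if_pos rfl]
    · exact (localView_of_notMem (X := {σ}) hs).trans (if_neg hs).symm

/-! ## The path of a selector -/

variable [Nontrivial V]

/-- The generic Dyck path of a `V_0`-selector. -/
def selectorPath (g : Selector G G.V0) : LabelledPath D.Edge :=
  D.genericPath (D.selectorVectors g) (D.validVectors_selectorVectors g)

theorem sinkView_selectorPath (g : Selector G G.V0) :
    D.sinkView (D.selectorPath g) = localView {σ} Set.univ '' {f | Extends f g} := by
  change D.admissibleViews _ 1 D.root = _
  rw [admissibleViews_one, admissible_selectorVectors]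

theorem selectorPath_mem (g : Selector G G.V0) : D.selectorPath g ∈ D.DyckClass := by
  have h2 := D.two_le_len
  refine ⟨D.isGeneric_genericPath _, rfl, _, D.admissibleViews_mem_lamIdx _ le_rfl (by omega),
    rfl, ?_⟩
  have := D.sinkView_selectorPath g
  change D.admissibleViews _ 1 D.root = _ at this
  rw [this]
  obtain ⟨f, hf⟩ := exists_extends g
  exact ⟨_, f, hf, rfl⟩

theorem exists_eq_selectorPath {π : LabelledPath D.Edge} (hπ : π ∈ D.DyckClass) :
    ∃ g, π = D.selectorPath g := by
  obtain ⟨b, hb, rfl, f, hf⟩ :=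
    D.exists_eq_genericPath (D.validVectors_selectorVectors (emptySelector G _)) hπ
  exact ⟨restrict f, D.genericPath_congr _ _ fun i hi => D.eq_selectorVectors hb hf hi⟩

theorem chosenEdges_selectorPath (g : Selector G G.V0) :
    D.chosenEdges (D.selectorPath g) = g.graph := by
  ext ⟨s, t⟩
  simp only [chosenEdges, Selector.graph, Set.mem_union, Set.mem_ofPred_eq, selectorPath,
    visits_genericPath]
  constructor
  · rintro (⟨i, B, B', u, hi, ⟨-, hB⟩, h0, hu, hBu, he⟩ |
      ⟨i, B, B', u, hi, ⟨-, hB⟩, h0, hu, hBu, he⟩)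
    · rw [Prod.mk.injEq] at he
      obtain ⟨rfl, rfl⟩ := he
      rw [← selectorChoice_eq_true h0, ← D.selectorVectors_fst g hu, hB]
      exact hBu
    · rw [Prod.mk.injEq] at he
      obtain ⟨rfl, rfl⟩ := he
      rw [← selectorChoice_eq_true h0, ← D.selectorVectors_snd g hu, hB]
      exact hBu
  · intro h
    obtain ⟨h0, hE⟩ := g.next_spec s t h
    rcases D.exists_critical_of_edge hE with ⟨i, hi, rfl, hm⟩ | ⟨i, hi, rfl, hm⟩
    · refine Or.inl ⟨i, _, _, t, hi, ⟨hi, rfl⟩, h0, hm, ?_, rfl⟩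
      exact (D.selectorVectors_fst g hm).trans ((selectorChoice_eq_true h0).2 h)
    · refine Or.inr ⟨i, _, _, s, hi, ⟨hi, rfl⟩, h0, hm, ?_, rfl⟩
      exact (D.selectorVectors_snd g hm).trans ((selectorChoice_eq_true h0).2 h)

theorem sinkView_eq_omegaView (g : Selector G G.V0) :
    D.sinkView (D.selectorPath g) = D.omegaView g 1 (D.node 1) := by
  rw [sinkView_selectorPath]
  ext φ
  simp only [omegaView, selView_one, Set.mem_image, Set.mem_ofPred_eq]
  exact exists_congr fun f => and_congr_right fun _ => eq_comm

theorem winsFrom_iff_sinkView [Finite V] (g : Selector G G.V0) :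
    WinsFrom g σ ↔ D.sinkView (D.selectorPath g) = {topAt σ} := by
  rw [winsFrom_iff, sinkView_selectorPath]
  obtain ⟨f₀, hf₀⟩ := exists_extends g
  constructor
  · intro h
    ext φ
    constructor
    · rintro ⟨f, hf, rfl⟩
      exact localView_eq_topAt.2 (h f hf)
    · rintro rfl
      exact ⟨f₀, hf₀, localView_eq_topAt.2 (h f₀ hf₀)⟩
  · intro h f hf
    exact localView_eq_topAt.1 (h.subset ⟨f, hf, rfl⟩)

end Traversal

end

end DyckParity

/-! ### The bijection between selectors and paths -/

theorem mainTheorem3 {V 𝒱 : Type*} [Finite V] [Nontrivial V] [Finite 𝒱] {C : ℕ}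
    (G : DyckParity.ParityGame V C) (σ : V) (D : DyckParity.Traversal G 𝒱 σ) :
    (∀ g : DyckParity.Selector G G.V0, ∃! π : D.DyckClass, D.chosenEdges π.1 = g.graph) ∧
    ∃ Φ : DyckParity.Selector G G.V0 → D.DyckClass,
      (∀ g, D.chosenEdges (Φ g).1 = g.graph) ∧
      Function.Bijective Φ ∧
      (∀ g, D.sinkView (Φ g).1 = D.omegaView g 1 (D.node 1)) ∧
      (∀ g, DyckParity.WinsFrom g σ ↔ D.sinkView (Φ g).1 = {DyckParity.topAt σ}) := by
  refine ⟨fun g => ⟨⟨_, D.selectorPath_mem g⟩, D.chosenEdges_selectorPath g, ?_⟩,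
    fun g => ⟨_, D.selectorPath_mem g⟩, D.chosenEdges_selectorPath, ⟨?_, ?_⟩,
    D.sinkView_eq_omegaView, D.winsFrom_iff_sinkView⟩
  · rintro ⟨π, hπ⟩ h
    obtain ⟨g', rfl⟩ := D.exists_eq_selectorPath hπ
    have hg : g' = g :=
      DyckParity.Traversal.graph_injective ((D.chosenEdges_selectorPath g').symm.trans h)
    subst hg
    rfl
  · intro g g' h
    have h' := congrArg (fun π : D.DyckClass => D.chosenEdges π.1) h
    dsimp only at h'
    rw [D.chosenEdges_selectorPath, D.chosenEdges_selectorPath] at h'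
    exact DyckParity.Traversal.graph_injective h'
  · rintro ⟨π, hπ⟩
    obtain ⟨g, rfl⟩ := D.exists_eq_selectorPath hπ
    exact ⟨g, rfl⟩
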